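/- Let $d,q\in\mathbb N$, let $b:\mathbb R^d\to\mathbb R^d$ and $\sigma:\mathbb R^d\to\mathbb M_{d,q}$, where $\mathbb M_{d,q}$ is the space of real $d\times q$ matrices, and let $|\cdot|$ be the Euclidean norm. **Assumptions.** (1) *Assumption (C):* $\sigma$ is bounded and Lipschitz continuous, and there is a $\mathcal C^2$ function $V:\mathbb R^d\to(0,\infty)$ with $\liminf_{|x|\to\infty}V(x)/|x|^2>0$, $|\nabla V|\le C\sqrt V$ for some constant $C$, and $D^2V$ bounded, such that $|b(x)|^2\le V(x)$ for all $x$, and such that for some $\beta\in\mathbb R$ and $\kappa>0$ one has $\langle\nabla V(x),b(x)\rangle\le\beta-\kappa V(x)$ for all $x$. (2) $b$ is Lipschitz continuous. (3) $\sigma$ is $(1+\alpha)$-Lipschitz for some $\alpha\in(0,1)$, that is, $\sigma$ is $\mathcal C^1$ and $$\sup_{x}\|D\sigma(x)\|+\sup_{x\neq y}\frac{\|D\sigma(x)-D\sigma(y)\|}{|x-y|^\alpha}<\infty .$$ (4) $\frac12<\theta\le1$ and $\alpha>\frac1\theta-1$. For $n\in\mathbb N$ let $\mathcal C^\theta(\mathbb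 R_+,\mathbb R^n)$ be the set of $f:\mathbb R_+\to\mathbb R^n$ such that $\|f\|_{\theta,T}=\sup_{0\le s<t\le T}\frac{|f(t)-f(s)|}{(t-s)^\theta}<\infty$ for every $T>0$, with the distance $$\delta_\theta(f,g)=\sum_{N\in\mathbb N}2^{-N}\Big(1\wedge\big(\sup_{0\le t\le N}|f(t)-g(t)|+\|f-g\|_{\theta,N}\big)\Big).$$ **Conclusions.** (i) For every $B\in\mathcal C^\theta(\mathbb R_+,\mathbb R^q)$ and every $x_0\in\mathbb R^d$ there is a unique $X\in\mathcal C^\theta(\mathbb R_+,\mathbb R^d)$ such that $$X_t=x_0+\int_0^t b(X_u)\,du+\int_0^t\sigma(X_u)\,dB_u\qquad\text{for all }t\ge0,$$ where both integrals exist in the Riemann–Stieltjes sense (limits of the tagged Riemann–Stieltjes sums as the mesh of the subdivision tends to $0$). (ii) The Itô map $\Phi:(x_0,B)\mapsto X$ is continuous from $\mathbb R^d\times\mathcal C^\theta(\mathbb R_+,\mathbb R^q)$ to $\mathcal C^\theta(\mathbb R_+,\mathbb R^d)$. -/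

import Mathlib

open scoped NNReal ENNReal

/-! ### Hölder paths on the half line -/

/-- The Hölder seminorm on `[0, T]`, that is the supremum over `0 ≤ s < t ≤ T` of
`|f t - f s| / (t - s) ^ θ`, as an extended non-negative number. -/
noncomputable def holderSeminorm {E : Type*} [NormedAddCommGroup E] (θ : ℝ) (T : ℝ≥0)
    (f : ℝ≥0 → E) : ℝ≥0∞ :=
  ⨆ (s : ℝ≥0) (t : ℝ≥0) (_ : s < t) (_ : t ≤ T),
    ‖f t - f s‖ₑ / ENNReal.ofReal (((t : ℝ) - (s : ℝ)) ^ θ)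

/-- The supremum of `|f t|` over `0 ≤ t ≤ T`. -/
noncomputable def supSeminorm {E : Type*} [NormedAddCommGroup E] (T : ℝ≥0)
    (f : ℝ≥0 → E) : ℝ≥0∞ :=
  ⨆ (t : ℝ≥0) (_ : t ≤ T), ‖f t‖ₑ

/-- The space of functions from `[0, ∞)` to `E` that are `θ`-Hölder on every `[0, T]`. -/
structure HolderPath (θ : ℝ) (E : Type*) [NormedAddCommGroup E] where
  /-- the underlying function -/
  toFun : ℝ≥0 → E
  /-- the Hölder seminorm is finite on every bounded interval -/
  holder : ∀ T : ℝ≥0, 0 < T → holderSeminorm θ T toFun < ⊤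

instance HolderPath.instCoeFun {θ : ℝ} {E : Type*} [NormedAddCommGroup E] :
    CoeFun (HolderPath θ E) (fun _ => ℝ≥0 → E) := ⟨HolderPath.toFun⟩

/-- The distance
`δ_θ (f, g) = ∑ N, 2 ^ (-N) * min 1 (sup_{t ≤ N} |f t - g t| + ‖f - g‖_{θ, N})`. -/
noncomputable def holderEDist {E : Type*} [NormedAddCommGroup E] (θ : ℝ)
    (f g : ℝ≥0 → E) : ℝ≥0∞ :=
  ∑' N : ℕ, (2 : ℝ≥0∞)⁻¹ ^ N *
    min 1 (supSeminorm (N : ℝ≥0) (f - g) + holderSeminorm θ (N : ℝ≥0) (f - g))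

theorem holderSeminorm_zero {E : Type*} [NormedAddCommGroup E] (θ : ℝ) (T : ℝ≥0) :
    holderSeminorm θ T (0 : ℝ≥0 → E) = 0 := by
  simp [holderSeminorm]

theorem supSeminorm_zero {E : Type*} [NormedAddCommGroup E] (T : ℝ≥0) :
    supSeminorm T (0 : ℝ≥0 → E) = 0 := by
  simp [supSeminorm]

theorem holderSeminorm_sub_comm {E : Type*} [NormedAddCommGroup E] (θ : ℝ) (T : ℝ≥0)
    (f g : ℝ≥0 → E) : holderSeminorm θ T (f - g) = holderSeminorm θ T (g - f) := by
  unfold holderSeminorm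
  have h : ∀ s t : ℝ≥0, ‖(f - g) t - (f - g) s‖ₑ = ‖(g - f) t - (g - f) s‖ₑ := by
    intro s t
    rw [← enorm_neg]
    congr 1
    simp only [Pi.sub_apply]
    abel
  simp only [h]

theorem supSeminorm_sub_comm {E : Type*} [NormedAddCommGroup E] (T : ℝ≥0)
    (f g : ℝ≥0 → E) : supSeminorm T (f - g) = supSeminorm T (g - f) := by
  unfold supSeminorm
  have h : ∀ t : ℝ≥0, ‖(f - g) t‖ₑ = ‖(g - f) t‖ₑ := by
    intro t
    rw [← enorm_neg]
    congr 1
    simp only [Pi.sub_apply]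
    abel
  simp only [h]

theorem holderSeminorm_add_le {E : Type*} [NormedAddCommGroup E] (θ : ℝ) (T : ℝ≥0)
    (f g : ℝ≥0 → E) :
    holderSeminorm θ T (f + g) ≤ holderSeminorm θ T f + holderSeminorm θ T g := by
  refine iSup_le fun s => iSup_le fun t => iSup_le fun hst => iSup_le fun htT => ?_
  have hf : ‖f t - f s‖ₑ / ENNReal.ofReal (((t : ℝ) - (s : ℝ)) ^ θ) ≤ holderSeminorm θ T f :=
    le_iSup_of_le s (le_iSup_of_le t (le_iSup_of_le hst (le_iSup_of_le htT le_rfl)))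
  have hg : ‖g t - g s‖ₑ / ENNReal.ofReal (((t : ℝ) - (s : ℝ)) ^ θ) ≤ holderSeminorm θ T g :=
    le_iSup_of_le s (le_iSup_of_le t (le_iSup_of_le hst (le_iSup_of_le htT le_rfl)))
  refine le_trans ?_ (add_le_add hf hg)
  rw [← ENNReal.add_div]
  refine ENNReal.div_le_div_right ?_ _
  have h : (f + g) t - (f + g) s = (f t - f s) + (g t - g s) := by
    simp only [Pi.add_apply]
    abel
  rw [h]
  exact enorm_add_le _ _

theorem supSeminorm_add_le {E : Type*} [NormedAddCommGroup E] (T : ℝ≥0)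
    (f g : ℝ≥0 → E) : supSeminorm T (f + g) ≤ supSeminorm T f + supSeminorm T g := by
  refine iSup_le fun t => iSup_le fun htT => ?_
  have hf : ‖f t‖ₑ ≤ supSeminorm T f := le_iSup_of_le t (le_iSup_of_le htT le_rfl)
  have hg : ‖g t‖ₑ ≤ supSeminorm T g := le_iSup_of_le t (le_iSup_of_le htT le_rfl)
  exact le_trans (enorm_add_le _ _) (add_le_add hf hg)

theorem holderEDist_triangle {E : Type*} [NormedAddCommGroup E] (θ : ℝ)
    (f g h : ℝ≥0 → E) : holderEDist θ f h ≤ holderEDist θ f g + holderEDist θ g h := by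
  unfold holderEDist
  rw [← ENNReal.tsum_add]
  refine ENNReal.tsum_le_tsum fun N => ?_
  rw [← mul_add]
  gcongr
  have e : f - h = (f - g) + (g - h) := by abel
  have h1 := add_le_add (supSeminorm_add_le (N : ℝ≥0) (f - g) (g - h))
    (holderSeminorm_add_le θ (N : ℝ≥0) (f - g) (g - h))
  rw [← e] at h1
  rw [add_add_add_comm] at h1
  refine le_trans (min_le_min le_rfl h1) ?_
  rcases le_total 1 (supSeminorm (N : ℝ≥0) (f - g) + holderSeminorm θ (N : ℝ≥0) (f - g)) with
    h2 | h2
  · rw [min_eq_left h2]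
    exact (min_le_left _ _).trans le_self_add
  · rcases le_total 1 (supSeminorm (N : ℝ≥0) (g - h) + holderSeminorm θ (N : ℝ≥0) (g - h)) with
      h3 | h3
    · rw [min_eq_left h3]
      exact (min_le_left _ _).trans le_add_self
    · rw [min_eq_right h2, min_eq_right h3]
      exact min_le_right _ _

theorem eq_of_holderEDist_eq_zero {E : Type*} [NormedAddCommGroup E] (θ : ℝ)
    (f g : ℝ≥0 → E) (h : holderEDist θ f g = 0) : f = g := by
  funext t
  obtain ⟨N, hN⟩ := exists_nat_ge t
  have h1 := ENNReal.tsum_eq_zero.1 h N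
  have h2 : min 1 (supSeminorm (N : ℝ≥0) (f - g) + holderSeminorm θ (N : ℝ≥0) (f - g)) = 0 := by
    rcases mul_eq_zero.1 h1 with h3 | h3
    · exact absurd h3 (pow_ne_zero _ (by simp))
    · exact h3
  have h4 : supSeminorm (N : ℝ≥0) (f - g) = 0 := by
    rcases min_choice (1 : ℝ≥0∞)
      (supSeminorm (N : ℝ≥0) (f - g) + holderSeminorm θ (N : ℝ≥0) (f - g)) with h5 | h5
    · rw [h5] at h2
      exact absurd h2 one_ne_zero
    · rw [h5] at h2
      exact (add_eq_zero.1 h2).1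
  have h6 : ‖(f - g) t‖ₑ ≤ supSeminorm (N : ℝ≥0) (f - g) :=
    le_iSup_of_le t (le_iSup_of_le hN le_rfl)
  rw [h4] at h6
  have h7 := enorm_eq_zero.1 (le_antisymm h6 bot_le)
  exact sub_eq_zero.1 h7

theorem holderEDist_ne_top {E : Type*} [NormedAddCommGroup E] (θ : ℝ)
    (f g : ℝ≥0 → E) : holderEDist θ f g ≠ ⊤ := by
  have h : holderEDist θ f g ≤ ∑' N : ℕ, (2 : ℝ≥0∞)⁻¹ ^ N :=
    ENNReal.tsum_le_tsum fun N => mul_le_of_le_one_right bot_le (min_le_left _ _)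
  rw [ENNReal.tsum_geometric, ENNReal.one_sub_inv_two, inv_inv] at h
  exact ne_top_of_le_ne_top (by simp) h

/-- The space of `θ`-Hölder paths with the extended distance `δ_θ` (which is finite). -/
noncomputable instance HolderPath.instEMetricSpace {θ : ℝ} {E : Type*} [NormedAddCommGroup E] :
    EMetricSpace (HolderPath θ E) where
  edist f g := holderEDist θ f g
  edist_self f := by simp [holderEDist, supSeminorm_zero, holderSeminorm_zero]
  edist_comm f g := by
    simp only [holderEDist, supSeminorm_sub_comm _ f.toFun g.toFun,
      holderSeminorm_sub_comm _ _ f.toFun g.toFun]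
  edist_triangle f g h := holderEDist_triangle θ f g h
  eq_of_edist_eq_zero {f g} h := by
    have h1 := eq_of_holderEDist_eq_zero θ f.toFun g.toFun h
    cases f
    cases g
    cases h1
    rfl

/-- The metric space of `θ`-Hölder paths, with the distance `δ_θ`. -/
noncomputable instance HolderPath.instMetricSpace {θ : ℝ} {E : Type*} [NormedAddCommGroup E] :
    MetricSpace (HolderPath θ E) :=
  EMetricSpace.toMetricSpace fun f g => holderEDist_ne_top θ f.toFun g.toFun

/-! ### Riemann-Stieltjes integrals and the equation -/

/-- `I` is the Riemann-Stieltjes integral of `f` against `g` over `[a, b]`: the limit of the sums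
`∑ f (u i) (g (t (i+1)) - g (t i))`, `t i ≤ u i ≤ t (i+1)`, over all tagged subdivisions of
`[a, b]`, as the mesh tends to `0`. The integrand takes values in linear maps, that is in
matrices. -/
def HasRSIntegral {F E : Type*} [NormedAddCommGroup F] [NormedSpace ℝ F]
    [NormedAddCommGroup E] [NormedSpace ℝ E]
    (f : ℝ≥0 → F →L[ℝ] E) (g : ℝ≥0 → F) (a b : ℝ≥0) (I : E) : Prop :=
  ∀ ε : ℝ, 0 < ε → ∃ δ : ℝ, 0 < δ ∧
    ∀ (n : ℕ) (t u : ℕ → ℝ≥0), t 0 = a → t n = b →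
      (∀ i < n, t i ≤ u i ∧ u i ≤ t (i + 1) ∧ (t (i + 1) : ℝ) - (t i : ℝ) < δ) →
      ‖(∑ i ∈ Finset.range n, f (u i) (g (t (i + 1)) - g (t i))) - I‖ < ε

/-- `X` solves `X t = x₀ + ∫₀ᵗ b (X u) du + ∫₀ᵗ σ (X u) dB u` for all `t ≥ 0`: both
Riemann-Stieltjes integrals exist (the first one has the integrator `u ↦ u`) and the equation
holds. -/
def IsSolution {F E : Type*} [NormedAddCommGroup F] [NormedSpace ℝ F]
    [NormedAddCommGroup E] [NormedSpace ℝ E]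
    (b : E → E) (σ : E → F →L[ℝ] E) (x₀ : E) (B : ℝ≥0 → F) (X : ℝ≥0 → E) : Prop :=
  ∀ t : ℝ≥0, ∃ I J : E,
    HasRSIntegral (fun u => ContinuousLinearMap.toSpanSingleton ℝ (b (X u)))
      (fun u => (u : ℝ)) 0 t I ∧
    HasRSIntegral (fun u => σ (X u)) B 0 t J ∧
    X t = x₀ + I + J

/-! ### Assumptions on the coefficients -/

/-- The norm `sup |Dσ x| + sup |Dσ x - Dσ y| / |x - y| ^ α`, as an extended non-negative
number. -/
noncomputable def onePlusLipschitzNorm {E G : Type*} [NormedAddCommGroup E] [NormedSpace ℝ E]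
    [NormedAddCommGroup G] [NormedSpace ℝ G] (α : ℝ) (σ : E → G) : ℝ≥0∞ :=
  (⨆ x : E, ‖fderiv ℝ σ x‖ₑ) +
    ⨆ (x : E) (y : E) (_ : x ≠ y), ‖fderiv ℝ σ x - fderiv ℝ σ y‖ₑ / ENNReal.ofReal (‖x - y‖ ^ α)

/-- `σ` is `(1 + α)`-Lipschitz, for `0 < α < 1`. -/
structure IsOnePlusLipschitz {E G : Type*} [NormedAddCommGroup E] [NormedSpace ℝ E]
    [NormedAddCommGroup G] [NormedSpace ℝ G] (α : ℝ) (σ : E → G) : Prop where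
  pos : 0 < α
  lt_one : α < 1
  contDiff : ContDiff ℝ 1 σ
  norm_lt_top : onePlusLipschitzNorm α σ < ⊤

/-- Essentially quadratic functions. -/
structure IsEssentiallyQuadratic {E : Type*} [NormedAddCommGroup E] [InnerProductSpace ℝ E]
    [CompleteSpace E] (V : E → ℝ) : Prop where
  contDiff : ContDiff ℝ 2 V
  pos : ∀ x, 0 < V x
  liminf_pos : 0 < Filter.liminf (fun x => ((V x / ‖x‖ ^ 2 : ℝ) : EReal)) (Bornology.cobounded E)
  gradient_le : ∃ C : ℝ, ∀ x, ‖gradient V x‖ ≤ C * Real.sqrt (V x)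
  hessian_bounded : ∃ C : ℝ, ∀ x, ‖fderiv ℝ (fderiv ℝ V) x‖ ≤ C

/-- The standing assumption: `σ` is bounded and Lipschitz, and `b` satisfies a growth and a
mean-reversion condition with respect to an essentially quadratic function. -/
structure AssumptionC {E G : Type*} [NormedAddCommGroup E] [InnerProductSpace ℝ E]
    [CompleteSpace E] [NormedAddCommGroup G] [NormedSpace ℝ G] (b : E → E) (σ : E → G) :
    Prop where
  bounded : ∃ M : ℝ, ∀ x, ‖σ x‖ ≤ M
  lipschitz : ∃ K : ℝ≥0, LipschitzWith K σ
  lyapunov : ∃ V : E → ℝ, IsEssentiallyQuadratic V ∧ (∀ x, ‖b x‖ ^ 2 ≤ V x) ∧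
    ∃ β κ : ℝ, 0 < κ ∧ ∀ x, inner ℝ (gradient V x) (b x) ≤ β - κ * V x

/-! The equation is solved pathwise by Young integration and a fixed-point argument in Hölder norms.
If `f` is `γ`-Hölder and `g` is `θ`-Hölder with `γ + θ > 1`, left-point sums of `f` against `g` over
`[s, t]` differ from `f s (g t - g s)` by at most a constant times `(t - s) ^ (γ + θ)`, uniformly in
the subdivision (`norm_sum_sub_le`). This bound yields both the integral (`exists_hasRSIntegral`)
and the estimate for it (`HasRSIntegral.norm_sub_le`).

The Picard map is controlled in Hölder norms at a small scale `η`, weighted by `exp (t / η)`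
(`WeightedBound`). Thanks to the weight, the supremum of a path is controlled by its starting value
plus `2 * D * η ^ θ * exp (t / η)`, with a factor that does not depend on the number of steps of
length `η` in `[0, T]`. Hence all of `[0, T]` is treated at once, without gluing local solutions.
Since `σ` is bounded and both coefficients are Lipschitz, the Picard map turns a bound `L` into `P +
Q * η ^ θ * L`, and a small `η` makes the last factor `1 / 2`
(`CoeffBounds.exists_invariance_scale`).

For differences, the Hölder norm of `σ (X) - σ (Y)` must be estimated linearly in `X - Y`. The
four-point inequality `four_point_le` does this, and costs regularity: because `Dσ` is only
`α`-Hölder, the result has exponent `α * θ`. Young's condition becomes `α * θ + θ > 1`, which is `α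
> 1 / θ - 1`. The Picard map then contracts differences by `1 / 2` up to a term linear in the
perturbation of the data (`CoeffBounds.exists_contraction_scale`).

Iteration gives existence. For solutions, a bound which improves itself by a factor `1 / 2` is
absorbed (`WeightedBound.of_halving`): this gives the a priori bound, and then the local Lipschitz
estimate `CoeffBounds.exists_stability_const`, which contains both uniqueness and continuity of the
Itô map. -/

/-! ### Hölder bounds on intervals -/

/-- `f` is `θ`-Hölder on `[a, b]` with constant `C`. -/
def HolderBound {E : Type*} [NormedAddCommGroup E] (θ C : ℝ) (a b : ℝ≥0) (f : ℝ≥0 → E) : Prop :=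
  ∀ s t : ℝ≥0, a ≤ s → s ≤ t → t ≤ b → ‖f t - f s‖ ≤ C * ((t : ℝ) - s) ^ θ

/-- `f` is `θ`-Hölder on every bounded interval. -/
def LocHolder {E : Type*} [NormedAddCommGroup E] (θ : ℝ) (f : ℝ≥0 → E) : Prop :=
  ∀ T : ℝ≥0, ∃ C : ℝ, 0 ≤ C ∧ HolderBound θ C 0 T f

theorem HolderBound.mono {E : Type*} [NormedAddCommGroup E] {θ C : ℝ} {a b a' b' : ℝ≥0}
    {f : ℝ≥0 → E} (h : HolderBound θ C a b f) (ha : a ≤ a') (hb : b' ≤ b) :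
    HolderBound θ C a' b' f :=
  fun s t h1 h2 h3 => h s t (ha.trans h1) h2 (h3.trans hb)

/-! ### Young's maximal inequality -/

/-- The constant in the Young-Loève estimate of exponent `μ > 1`. -/
noncomputable def youngConst (μ : ℝ) : ℝ := 2 / (1 - 2 ^ (1 - μ))

theorem youngConst_pos {μ : ℝ} (hμ : 1 < μ) : 0 < youngConst μ := by
  have : (2 : ℝ) ^ (1 - μ) < 1 := Real.rpow_lt_one_of_one_lt_of_neg (by norm_num) (by linarith)
  unfold youngConst
  apply div_pos <;> linarith

/-- The fixed-point equation behind the dyadic induction: two halves, each scaled by `(1 / 2) ^ μ`,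
plus two cross terms. It has a positive solution because `2 * (1 / 2) ^ μ < 1`. -/
theorem youngConst_eq {μ : ℝ} (hμ : 1 < μ) :
    2 * youngConst μ * (1 / 2) ^ μ + 2 = youngConst μ := by
  have h1 : (2 : ℝ) ^ (1 - μ) < 1 := Real.rpow_lt_one_of_one_lt_of_neg (by norm_num) (by linarith)
  have h2 : (2 : ℝ) ^ (1 - μ) = 2 * (1 / 2) ^ μ := by
    rw [Real.rpow_sub (by norm_num), Real.rpow_one, one_div, Real.inv_rpow (by norm_num),
      div_eq_mul_inv]
  have h3 : 1 - (2 : ℝ) ^ (1 - μ) ≠ 0 := by linarith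
  have h4 : youngConst μ * (1 - (2 : ℝ) ^ (1 - μ)) = 2 := by
    unfold youngConst
    field_simp
  rw [h2] at h4
  linarith

section Young

variable {F E : Type*} [NormedAddCommGroup F] [NormedSpace ℝ F]
  [NormedAddCommGroup E] [NormedSpace ℝ E]

theorem norm_sub_apply_sub_le {f : ℝ≥0 → F →L[ℝ] E} {g : ℝ≥0 → F} {γ θ A M : ℝ} {a b : ℝ≥0}
    (hγ : 0 < γ) (hθ : 0 < θ) (hA : 0 ≤ A) (hM : 0 ≤ M)
    (hf : HolderBound γ A a b f) (hg : HolderBound θ M a b g)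
    {s t u v : ℝ≥0} {ℓ : ℝ} (hs : a ≤ s) (hst : s ≤ t) (ht : t ≤ b) (hu : a ≤ u) (huv : u ≤ v)
    (hv : v ≤ b) (h1 : (t : ℝ) - s ≤ ℓ) (h2 : (v : ℝ) - u ≤ ℓ) :
    ‖(f t - f s) (g v - g u)‖ ≤ A * M * ℓ ^ (γ + θ) := by
  have e1 : (0 : ℝ) ≤ (t : ℝ) - s := sub_nonneg.2 (by exact_mod_cast hst)
  have e2 : (0 : ℝ) ≤ (v : ℝ) - u := sub_nonneg.2 (by exact_mod_cast huv)
  have hℓ : 0 ≤ ℓ := e1.trans h1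
  have i1 : ‖f t - f s‖ ≤ A * ℓ ^ γ := (hf s t hs hst ht).trans (by gcongr)
  have i2 : ‖g v - g u‖ ≤ M * ℓ ^ θ := (hg u v hu huv hv).trans (by gcongr)
  calc ‖(f t - f s) (g v - g u)‖ ≤ ‖f t - f s‖ * ‖g v - g u‖ := ContinuousLinearMap.le_opNorm _ _
    _ ≤ (A * ℓ ^ γ) * (M * ℓ ^ θ) := by gcongr
    _ = A * M * ℓ ^ (γ + θ) := by
      rw [Real.rpow_add_of_nonneg hℓ hγ.le hθ.le]
      ring

/-- Young's maximal inequality for left-point sums. -/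
theorem norm_sum_sub_le {f : ℝ≥0 → F →L[ℝ] E} {g : ℝ≥0 → F} {γ θ A M : ℝ} {a b : ℝ≥0}
    (hγ : 0 < γ) (hθ : 0 < θ) (hμ : 1 < γ + θ) (hA : 0 ≤ A) (hM : 0 ≤ M)
    (hf : HolderBound γ A a b f) (hg : HolderBound θ M a b g)
    {t : ℕ → ℝ≥0} (ht : Monotone t) (hta : ∀ i, a ≤ t i) (htb : ∀ i, t i ≤ b) (m : ℕ) :
    ∀ i, ‖(∑ k ∈ Finset.range m, f (t (i + k)) (g (t (i + k + 1)) - g (t (i + k)))) -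
      f (t i) (g (t (i + m)) - g (t i))‖ ≤
      youngConst (γ + θ) * (A * M) * ((t (i + m) : ℝ) - t i) ^ (γ + θ) := by
  induction m using Nat.strong_induction_on with
  | _ m ih =>
  intro i
  have hC := youngConst_pos hμ
  rcases Nat.eq_zero_or_pos m with rfl | hm
  · simp only [Finset.range_zero, Finset.sum_empty, add_zero, sub_self, map_zero, norm_zero]
    positivity
  set ℓ : ℝ := (t (i + m) : ℝ) - t i with hℓ
  have hmr : ∀ {j k : ℕ}, j ≤ k → (t j : ℝ) ≤ t k := fun h => by exact_mod_cast ht h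
  have hℓ0 : 0 ≤ ℓ := sub_nonneg.2 (hmr (by omega))
  -- Cut out the one cell that contains the midpoint: `k` is the last index below `m` whose point
  -- lies in the first half, so the blocks before and after the cell `[t (i + k), t (i + k + 1)]`
  -- both have length at most `ℓ / 2`.
  obtain ⟨k, hkm, hk1, hk2⟩ : ∃ k < m, (t (i + k) : ℝ) - t i ≤ ℓ / 2 ∧
      (t (i + m) : ℝ) - t (i + k + 1) ≤ ℓ / 2 := by
    classical
    let p : ℕ → Prop := fun k => (t (i + k) : ℝ) - t i ≤ ℓ / 2
    have hp0 : p 0 := by simp only [p, add_zero, sub_self]; positivity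
    refine ⟨Nat.findGreatest p (m - 1), ?_, ?_, ?_⟩
    · have := Nat.findGreatest_le (P := p) (m - 1)
      omega
    · exact Nat.findGreatest_spec (P := p) (Nat.zero_le _) hp0
    · have h1 := Nat.findGreatest_le (P := p) (m - 1)
      set k := Nat.findGreatest p (m - 1) with hk
      rcases Nat.lt_or_ge k (m - 1) with h2 | h2
      · have h3 : ¬ p (k + 1) := Nat.findGreatest_is_greatest (n := m - 1) (Nat.lt_succ_self k) (by omega)
        simp only [p, not_le, ← add_assoc] at h3
        linarith
      · have : i + k + 1 = i + m := by omega
        rw [this]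
        linarith
  obtain ⟨r, rfl⟩ : ∃ r, m = k + 1 + r := ⟨m - (k + 1), by omega⟩
  have e1 := ih k hkm i
  have e2 := ih r (by omega) (i + k + 1)
  have er : i + k + 1 + r = i + (k + 1 + r) := by omega
  rw [er] at e2
  have b1 : ‖(f (t (i + k)) - f (t i)) (g (t (i + k + 1)) - g (t (i + k)))‖ ≤
      A * M * ℓ ^ (γ + θ) := by
    refine norm_sub_apply_sub_le hγ hθ hA hM hf hg (hta _) (ht (by omega)) (htb _) (hta _)
      (ht (by omega)) (htb _) ?_ ?_
    · linarith
    · have := hmr (show i + k + 1 ≤ i + (k + 1 + r) by omega)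
      have := hmr (show i ≤ i + k by omega)
      linarith
  have b2 : ‖(f (t (i + k + 1)) - f (t i)) (g (t (i + (k + 1 + r))) - g (t (i + k + 1)))‖ ≤
      A * M * ℓ ^ (γ + θ) := by
    refine norm_sub_apply_sub_le hγ hθ hA hM hf hg (hta _) (ht (by omega)) (htb _) (hta _)
      (ht (by omega)) (htb _) ?_ ?_
    · have := hmr (show i + k + 1 ≤ i + (k + 1 + r) by omega)
      linarith
    · linarith
  -- The errors of the two blocks fall under the induction hypothesis; moving the base point of the
  -- middle cell and of the right block to `t i` produces the two cross terms.
  have hsplit : (∑ j ∈ Finset.range (k + 1 + r),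
      f (t (i + j)) (g (t (i + j + 1)) - g (t (i + j)))) -
      f (t i) (g (t (i + (k + 1 + r))) - g (t i)) =
      ((∑ j ∈ Finset.range k, f (t (i + j)) (g (t (i + j + 1)) - g (t (i + j)))) -
        f (t i) (g (t (i + k)) - g (t i))) +
      ((∑ j ∈ Finset.range r,
        f (t (i + k + 1 + j)) (g (t (i + k + 1 + j + 1)) - g (t (i + k + 1 + j)))) -
        f (t (i + k + 1)) (g (t (i + (k + 1 + r))) - g (t (i + k + 1)))) +
      (f (t (i + k)) - f (t i)) (g (t (i + k + 1)) - g (t (i + k))) +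
      (f (t (i + k + 1)) - f (t i)) (g (t (i + (k + 1 + r))) - g (t (i + k + 1))) := by
    rw [Finset.sum_range_add, Finset.sum_range_succ]
    have : ∀ j, i + (k + 1 + j) = i + k + 1 + j := fun j => by omega
    simp only [this, map_sub, sub_apply]
    abel
  rw [hsplit]
  have hAM : 0 ≤ A * M := mul_nonneg hA hM
  have hhalf : ∀ x : ℝ, 0 ≤ x → x ≤ ℓ / 2 → x ^ (γ + θ) ≤ (1 / 2) ^ (γ + θ) * ℓ ^ (γ + θ) := by
    intro x hx0 hx
    rw [← Real.mul_rpow (by norm_num) hℓ0]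
    exact Real.rpow_le_rpow hx0 (by linarith) (by linarith)
  have e1' := hhalf _ (sub_nonneg.2 (hmr (show i ≤ i + k by omega))) hk1
  have e2' := hhalf _ (sub_nonneg.2 (hmr (show i + k + 1 ≤ i + (k + 1 + r) by omega))) hk2
  have hCAM : 0 ≤ youngConst (γ + θ) * (A * M) := by positivity
  have e3 := mul_le_mul_of_nonneg_left e1' hCAM
  have e4 := mul_le_mul_of_nonneg_left e2' hCAM
  refine (norm_add_le _ _).trans (le_trans (add_le_add ((norm_add_le _ _).trans
    (add_le_add ((norm_add_le _ _).trans (add_le_add (e1.trans e3) (e2.trans e4))) b1)) b2) ?_)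
  have := youngConst_eq hμ
  have h5 : youngConst (γ + θ) * (A * M) * ℓ ^ (γ + θ) =
      (2 * youngConst (γ + θ) * (1 / 2) ^ (γ + θ) + 2) * (A * M) * ℓ ^ (γ + θ) := by rw [this]
  rw [h5]
  apply le_of_eq
  ring

/-! ### Basic properties of Riemann-Stieltjes integrals -/

/-- The sequence is monotone and stays in `[a, b]` for all indices, even past `n`, which is the form
`norm_sum_sub_le` takes. -/
theorem exists_partition {a b : ℝ≥0} (hab : a ≤ b) {δ : ℝ} (hδ : 0 < δ) :
    ∃ (n : ℕ) (t : ℕ → ℝ≥0), Monotone t ∧ t 0 = a ∧ t n = b ∧ (∀ i, a ≤ t i) ∧ (∀ i, t i ≤ b) ∧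
      ∀ i, (t (i + 1) : ℝ) - t i < δ := by
  lift δ to ℝ≥0 using hδ.le
  have hδ' : 0 < δ := by exact_mod_cast hδ
  obtain ⟨n, hn⟩ := exists_nat_ge ((b - a) / (δ / 2))
  refine ⟨n, fun i => min (a + i * (δ / 2)) b, ?_, ?_, ?_, ?_, ?_, ?_⟩
  · intro i j hij
    dsimp only
    gcongr
  · simp [hab]
  · rw [div_le_iff₀ (by positivity)] at hn
    exact min_eq_right (tsub_le_iff_left.1 hn)
  · intro i
    exact le_min le_self_add hab
  · intro i
    exact min_le_right _ _
  · intro i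
    have : min (a + ((i + 1 : ℕ) : ℝ≥0) * (δ / 2)) b ≤ min (a + i * (δ / 2)) b + δ / 2 := by
      rw [← min_add_add_right]
      refine min_le_min ?_ le_self_add
      push_cast
      apply le_of_eq
      ring
    have h2 := NNReal.coe_le_coe.2 this
    rw [NNReal.coe_add, NNReal.coe_div, NNReal.coe_ofNat] at h2
    have : (0 : ℝ) < δ := hδ
    linarith

/-- The integral is a limit of left-point sums along subdivisions from `exists_partition`, so any
closed bound that is uniform over such sums passes to it. -/
theorem HasRSIntegral.norm_sub_le_of_forall {f : ℝ≥0 → F →L[ℝ] E} {g : ℝ≥0 → F} {a b : ℝ≥0}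
    {I v : E} {C : ℝ} (h : HasRSIntegral f g a b I) (hab : a ≤ b)
    (hC : ∀ (n : ℕ) (t : ℕ → ℝ≥0), Monotone t → t 0 = a → t n = b → (∀ i, a ≤ t i) →
      (∀ i, t i ≤ b) →
      ‖(∑ i ∈ Finset.range n, f (t i) (g (t (i + 1)) - g (t i))) - v‖ ≤ C) :
    ‖I - v‖ ≤ C := by
  refine le_of_forall_pos_le_add fun ε hε => ?_
  obtain ⟨δ, hδ, hδ'⟩ := h ε hε
  obtain ⟨n, t, hm, h0, hn, hta, htb, hmesh⟩ := exists_partition hab hδ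
  have h1 := hδ' n t t h0 hn fun i _ => ⟨le_rfl, hm (Nat.le_succ i), hmesh i⟩
  have h2 := hC n t hm h0 hn hta htb
  rw [← norm_neg, neg_sub] at h1
  have := norm_sub_le_norm_sub_add_norm_sub I
    (∑ i ∈ Finset.range n, f (t i) (g (t (i + 1)) - g (t i))) v
  linarith

theorem HasRSIntegral.sub_left {f₁ f₂ : ℝ≥0 → F →L[ℝ] E} {g : ℝ≥0 → F} {a b : ℝ≥0} {I₁ I₂ : E}
    (h₁ : HasRSIntegral f₁ g a b I₁) (h₂ : HasRSIntegral f₂ g a b I₂) :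
    HasRSIntegral (fun u => f₁ u - f₂ u) g a b (I₁ - I₂) := by
  intro ε hε
  obtain ⟨δ₁, hδ₁, H₁⟩ := h₁ (ε / 2) (by positivity)
  obtain ⟨δ₂, hδ₂, H₂⟩ := h₂ (ε / 2) (by positivity)
  refine ⟨min δ₁ δ₂, lt_min hδ₁ hδ₂, fun n t u h0 hn h => ?_⟩
  have e1 := H₁ n t u h0 hn fun i hi =>
    ⟨(h i hi).1, (h i hi).2.1, (h i hi).2.2.trans_le (min_le_left _ _)⟩
  have e2 := H₂ n t u h0 hn fun i hi =>
    ⟨(h i hi).1, (h i hi).2.1, (h i hi).2.2.trans_le (min_le_right _ _)⟩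
  simp only [sub_apply, Finset.sum_sub_distrib]
  rw [sub_sub_sub_comm]
  exact (norm_sub_le _ _).trans_lt (by linarith)

theorem HasRSIntegral.sub_right {f : ℝ≥0 → F →L[ℝ] E} {g₁ g₂ : ℝ≥0 → F} {a b : ℝ≥0} {I₁ I₂ : E}
    (h₁ : HasRSIntegral f g₁ a b I₁) (h₂ : HasRSIntegral f g₂ a b I₂) :
    HasRSIntegral f (fun u => g₁ u - g₂ u) a b (I₁ - I₂) := by
  intro ε hε
  obtain ⟨δ₁, hδ₁, H₁⟩ := h₁ (ε / 2) (by positivity)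
  obtain ⟨δ₂, hδ₂, H₂⟩ := h₂ (ε / 2) (by positivity)
  refine ⟨min δ₁ δ₂, lt_min hδ₁ hδ₂, fun n t u h0 hn h => ?_⟩
  have e1 := H₁ n t u h0 hn fun i hi =>
    ⟨(h i hi).1, (h i hi).2.1, (h i hi).2.2.trans_le (min_le_left _ _)⟩
  have e2 := H₂ n t u h0 hn fun i hi =>
    ⟨(h i hi).1, (h i hi).2.1, (h i hi).2.2.trans_le (min_le_right _ _)⟩
  have e : (∑ i ∈ Finset.range n, f (u i) (g₁ (t (i + 1)) - g₂ (t (i + 1)) - (g₁ (t i) - g₂ (t i))))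
      - (I₁ - I₂) = ((∑ i ∈ Finset.range n, f (u i) (g₁ (t (i + 1)) - g₁ (t i))) - I₁) -
      ((∑ i ∈ Finset.range n, f (u i) (g₂ (t (i + 1)) - g₂ (t i))) - I₂) := by
    rw [sub_sub_sub_comm, ← Finset.sum_sub_distrib]
    simp only [← map_sub, sub_sub_sub_comm]
  rw [e]
  exact (norm_sub_le _ _).trans_lt (by linarith)

theorem HasRSIntegral.unique {f : ℝ≥0 → F →L[ℝ] E} {g : ℝ≥0 → F} {a b : ℝ≥0} {I₁ I₂ : E}
    (hab : a ≤ b) (h₁ : HasRSIntegral f g a b I₁) (h₂ : HasRSIntegral f g a b I₂) : I₁ = I₂ := by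
  have h := (h₁.sub_left h₂).norm_sub_le_of_forall (v := 0) (C := 0) hab fun n t _ _ _ _ _ => by
    simp
  rw [sub_zero] at h
  exact sub_eq_zero.1 (norm_le_zero_iff.1 h)

/-- The Young-Loève estimate. -/
theorem HasRSIntegral.norm_sub_le {f : ℝ≥0 → F →L[ℝ] E} {g : ℝ≥0 → F} {γ θ A M : ℝ} {a b : ℝ≥0}
    {I : E} (h : HasRSIntegral f g a b I) (hab : a ≤ b)
    (hγ : 0 < γ) (hθ : 0 < θ) (hμ : 1 < γ + θ) (hA : 0 ≤ A) (hM : 0 ≤ M)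
    (hf : HolderBound γ A a b f) (hg : HolderBound θ M a b g) :
    ‖I - f a (g b - g a)‖ ≤ youngConst (γ + θ) * (A * M) * ((b : ℝ) - a) ^ (γ + θ) := by
  refine h.norm_sub_le_of_forall hab fun n t hm h0 hn hta htb => ?_
  have := norm_sum_sub_le hγ hθ hμ hA hM hf hg hm hta htb n 0
  simpa only [zero_add, h0, hn] using this

theorem HasRSIntegral.norm_le_of_norm_le {f : ℝ≥0 → ℝ →L[ℝ] E} {a b : ℝ≥0} {I : E} {C : ℝ}
    (h : HasRSIntegral f (fun u => (u : ℝ)) a b I) (hab : a ≤ b)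
    (hC : ∀ u, a ≤ u → u ≤ b → ‖f u‖ ≤ C) : ‖I‖ ≤ C * ((b : ℝ) - a) := by
  rw [← sub_zero I]
  refine h.norm_sub_le_of_forall hab fun n t hm h0 hn hta htb => ?_
  rw [sub_zero]
  calc _ ≤ ∑ i ∈ Finset.range n, C * ((t (i + 1) : ℝ) - t i) := by
        refine norm_sum_le_of_le _ fun i _ => ?_
        refine (ContinuousLinearMap.le_opNorm _ _).trans ?_
        have : (0 : ℝ) ≤ (t (i + 1) : ℝ) - t i :=
          sub_nonneg.2 (by exact_mod_cast hm (Nat.le_succ i))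
        rw [Real.norm_of_nonneg this]
        gcongr
        exact hC _ (hta i) (htb i)
    _ = C * ((b : ℝ) - a) := by
        rw [← Finset.mul_sum, Finset.sum_range_sub (fun i => (t i : ℝ)), h0, hn]

/-! ### Existence of the Young integral -/

/-- A two-point estimate of exponent `μ > 1` identifies the increments of `J` as Riemann-Stieltjes
integrals. -/
theorem hasRSIntegral_of_norm_sub_le {f : ℝ≥0 → F →L[ℝ] E} {g : ℝ≥0 → F} {γ θ A M C : ℝ}
    {a b : ℝ≥0} (hγ : 0 < γ) (hθ : 0 < θ) (hμ : 1 < γ + θ) (hA : 0 ≤ A) (hM : 0 ≤ M) (hC : 0 ≤ C)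
    (hf : HolderBound γ A a b f) (hg : HolderBound θ M a b g) {J : ℝ≥0 → E}
    (hJ : ∀ s t, a ≤ s → s ≤ t → t ≤ b →
      ‖J t - J s - f s (g t - g s)‖ ≤ C * ((t : ℝ) - s) ^ (γ + θ)) :
    HasRSIntegral f g a b (J b - J a) := by
  intro ε hε
  -- With mesh below `δ`, each cell contributes at most `(A * M + C) * δ ^ (γ + θ - 1)` times its
  -- length: `A * M` pays for the tag and `C` for the two-point estimate. The choice of `δ` makes
  -- this power equal to `ε / D`, and the final `+ 1` makes the total strictly less than `ε`.
  set D : ℝ := (A * M + C) * (b + 1) + 1 with hD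
  have hD0 : 0 < D := by positivity
  have hη : 0 < ε / D := by positivity
  refine ⟨(ε / D) ^ (1 / (γ + θ - 1)), by positivity, fun n t u h0 hn h => ?_⟩
  set δ := (ε / D) ^ (1 / (γ + θ - 1)) with hδ
  have hδμ : δ ^ (γ + θ - 1) = ε / D := by
    rw [hδ, ← Real.rpow_mul hη.le, one_div_mul_cancel (by linarith), Real.rpow_one]
  have hmono : ∀ i j, i ≤ j → j ≤ n → t i ≤ t j := by
    intro i j hij
    induction j, hij using Nat.le_induction with
    | base => exact fun _ => le_rfl
    | succ j _ ih =>
      intro hj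
      exact (ih (by omega)).trans ((h j (by omega)).1.trans (h j (by omega)).2.1)
  have hta : ∀ i ≤ n, a ≤ t i := fun i hi => h0 ▸ hmono 0 i (Nat.zero_le _) hi
  have htb : ∀ i ≤ n, t i ≤ b := fun i hi => hn ▸ hmono i n hi le_rfl
  have hab : a ≤ b := (hta n le_rfl).trans (htb n le_rfl)
  have hab' : (a : ℝ) ≤ b := by exact_mod_cast hab
  have hsum : J b - J a = ∑ i ∈ Finset.range n, (J (t (i + 1)) - J (t i)) := by
    rw [Finset.sum_range_sub (fun i => J (t i)), h0, hn]
  rw [hsum, ← Finset.sum_sub_distrib]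
  calc _ ≤ ∑ i ∈ Finset.range n, (A * M + C) * (ε / D) * ((t (i + 1) : ℝ) - t i) := by
        refine norm_sum_le_of_le _ fun i hi => ?_
        have hi' := Finset.mem_range.1 hi
        obtain ⟨h1, h2, h3⟩ := h i hi'
        have h12 : (t i : ℝ) ≤ t (i + 1) := by exact_mod_cast h1.trans h2
        have h2' : (u i : ℝ) ≤ t (i + 1) := by exact_mod_cast h2
        have e1 := norm_sub_apply_sub_le hγ hθ hA hM hf hg (hta i hi'.le) h1
          (h2.trans (htb _ hi')) (hta i hi'.le) (h1.trans h2) (htb _ hi')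
          (show (u i : ℝ) - t i ≤ (t (i + 1) : ℝ) - t i by linarith) le_rfl
        have e2 := hJ (t i) (t (i + 1)) (hta i hi'.le) (h1.trans h2) (htb _ hi')
        have e3 : ((t (i + 1) : ℝ) - t i) ^ (γ + θ) ≤ (ε / D) * ((t (i + 1) : ℝ) - t i) := by
          have e4 : γ + θ = (γ + θ - 1) + 1 := by ring
          rw [e4, Real.rpow_add_of_nonneg (by linarith) (by linarith) (by norm_num), Real.rpow_one,
            ← hδμ]
          gcongr
        have e5 : f (u i) (g (t (i + 1)) - g (t i)) - (J (t (i + 1)) - J (t i)) =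
            (f (u i) - f (t i)) (g (t (i + 1)) - g (t i)) -
            (J (t (i + 1)) - J (t i) - f (t i) (g (t (i + 1)) - g (t i))) := by
          simp only [sub_apply]
          abel
        rw [e5]
        refine (norm_sub_le _ _).trans ((add_le_add e1 e2).trans ?_)
        rw [← add_mul, mul_assoc]
        gcongr
    _ = (A * M + C) * (b - a) * (ε / D) := by
        rw [← Finset.mul_sum, Finset.sum_range_sub (fun i => (t i : ℝ)), h0, hn]
        ring
    _ < D * (ε / D) := by
        have : (A * M + C) * (b - a) ≤ (A * M + C) * (b + 1) := by
          gcongr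
          have : (0 : ℝ) ≤ a := a.2
          linarith
        gcongr
        linarith
    _ = ε := by field_simp

/-- The left-point sums over the grid of step `1 / (n + 1)` in `[0, n + 1]`, stopped at `t`. -/
noncomputable def gridSum (f : ℝ≥0 → F →L[ℝ] E) (g : ℝ≥0 → F) (n : ℕ) (t : ℝ≥0) : E :=
  ∑ i ∈ Finset.range ((n + 1) ^ 2), f (i / (n + 1))
    (g (min (((i + 1 : ℕ) : ℝ≥0) / (n + 1)) t) - g (min ((i : ℝ≥0) / (n + 1)) t))

/-- Subtracting two stopped sums leaves the same grid with its cells clipped to `[s, t]`; the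
integrand is still evaluated at the unclipped grid points. -/
theorem gridSum_sub (f : ℝ≥0 → F →L[ℝ] E) (g : ℝ≥0 → F) (n : ℕ) {s t : ℝ≥0} (hst : s ≤ t) :
    gridSum f g n t - gridSum f g n s =
      ∑ i ∈ Finset.range ((n + 1) ^ 2), f (i / (n + 1))
        (g (max s (min (((i + 1 : ℕ) : ℝ≥0) / (n + 1)) t)) -
          g (max s (min ((i : ℝ≥0) / (n + 1)) t))) := by
  have key : ∀ x, g (min x t) - g (min x s) = g (max s (min x t)) - g s := by
    intro x
    rcases le_total x s with h | h
    · rw [min_eq_left h, min_eq_left (h.trans hst), max_eq_left h, sub_self, sub_self]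
    · rw [min_eq_right h, max_eq_right (le_min h hst)]
  unfold gridSum
  rw [← Finset.sum_sub_distrib]
  refine Finset.sum_congr rfl fun i _ => ?_
  rw [← map_sub, sub_sub_sub_comm, key, key, sub_sub_sub_cancel_right]

/-- Replacing the grid points by the clipped ones gives a left-point sum on `[s, t]`, to which
Young's maximal inequality applies. The replacement matters only in the cell around `s`, hence an
error of order `(1 / (n + 1)) ^ (γ + θ)`, which vanishes in the limit. -/
theorem norm_gridSum_sub_le {f : ℝ≥0 → F →L[ℝ] E} {g : ℝ≥0 → F} {γ θ A M : ℝ}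
    (hγ : 0 < γ) (hθ : 0 < θ) (hμ : 1 < γ + θ) (hA : 0 ≤ A) (hM : 0 ≤ M) {T : ℝ≥0}
    (hf : HolderBound γ A 0 T f) (hg : HolderBound θ M 0 T g) {n : ℕ} {s t : ℝ≥0} (hst : s ≤ t)
    (htT : t ≤ T) (htn : t ≤ n) :
    ‖gridSum f g n t - gridSum f g n s - f s (g t - g s)‖ ≤
      youngConst (γ + θ) * (A * M) * ((t : ℝ) - s) ^ (γ + θ) +
        A * M * (1 / ((n : ℝ) + 1)) ^ (γ + θ) := by
  set p : ℕ → ℝ≥0 := fun i => (i : ℝ≥0) / (n + 1) with hp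
  set c : ℕ → ℝ≥0 := fun i => max s (min (p i) t) with hc
  have hn0 : (0 : ℝ≥0) < n + 1 := by positivity
  have hpm : Monotone p := fun i j hij => by simp only [hp]; gcongr
  have hcm : Monotone c := fun i j hij => max_le_max le_rfl (min_le_min (hpm hij) le_rfl)
  have hcs : ∀ i, s ≤ c i := fun i => le_max_left _ _
  have hct : ∀ i, c i ≤ t := fun i => max_le hst (min_le_right _ _)
  have hc0 : c 0 = s := by simp [hc, hp]
  have hcN : c ((n + 1) ^ 2) = t := by
    have : p ((n + 1) ^ 2) = n + 1 := by
      simp only [hp]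
      push_cast
      field_simp
    simp only [hc]
    rw [this, min_eq_right (htn.trans le_self_add), max_eq_right hst]
  have e1 := norm_sum_sub_le hγ hθ hμ hA hM (hf.mono (zero_le) htT) (hg.mono (zero_le) htT)
    hcm hcs hct ((n + 1) ^ 2) 0
  simp only [zero_add, hc0, hcN] at e1
  have e2 : ‖∑ i ∈ Finset.range ((n + 1) ^ 2), (f (p i) - f (c i)) (g (c (i + 1)) - g (c i))‖ ≤
      A * M * (1 / ((n : ℝ) + 1)) ^ (γ + θ) := by
    set k := ⌊s * (n + 1)⌋₊ with hk
    have hk1 : p k ≤ s := by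
      simp only [hp]
      rw [div_le_iff₀ hn0]
      exact Nat.floor_le (zero_le)
    have hk2 : s ≤ p (k + 1) := by
      simp only [hp]
      rw [le_div_iff₀ hn0]
      push_cast
      exact (Nat.lt_floor_add_one _).le
    -- Cells before `k` collapse to `s`; later cells either start at an unclipped grid point or
    -- collapse to `t`.
    have hz : ∀ i, i ≠ k → (f (p i) - f (c i)) (g (c (i + 1)) - g (c i)) = 0 := by
      intro i hi
      rcases lt_or_gt_of_ne hi with h | h
      · have h1 : p (i + 1) ≤ s := (hpm h).trans hk1
        have h2 : p i ≤ s := (hpm (Nat.le_succ i)).trans h1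
        have : c (i + 1) = c i := by
          simp only [hc]
          rw [max_eq_left ((min_le_left _ _).trans h1), max_eq_left ((min_le_left _ _).trans h2)]
        rw [this, sub_self, map_zero]
      · have h1 : s ≤ p i := hk2.trans (hpm h)
        rcases le_total (p i) t with h2 | h2
        · have : c i = p i := by
            simp only [hc]
            rw [min_eq_left h2, max_eq_right h1]
          rw [this, sub_self, zero_apply]
        · have : c (i + 1) = c i := by
            simp only [hc]
            rw [min_eq_right h2, min_eq_right (h2.trans (hpm (Nat.le_succ i)))]
          rw [this, sub_self, map_zero]
    rw [Finset.sum_eq_single k (fun i _ hi => hz i hi)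
      (fun hk' => by
        have : c k = t := by
          refine le_antisymm (hct k) ?_
          rw [← hcN]
          exact hcm (by simpa using hk')
        have h2 : c (k + 1) = t := le_antisymm (hct _) (this ▸ hcm (Nat.le_succ k))
        rw [this, h2, sub_self, map_zero])]
    have hck : c k = s := max_eq_left ((min_le_left _ _).trans hk1)
    have hpk : (p (k + 1) : ℝ) = p k + 1 / ((n : ℝ) + 1) := by
      simp only [hp]
      push_cast
      ring
    have hk1' : (p k : ℝ) ≤ s := by exact_mod_cast hk1
    have hk2' : (s : ℝ) ≤ p (k + 1) := by exact_mod_cast hk2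
    have hck1 : c (k + 1) ≤ p (k + 1) := max_le hk2 (min_le_left _ _)
    have hck1' : (c (k + 1) : ℝ) ≤ p (k + 1) := by exact_mod_cast hck1
    rw [hck, ← norm_neg, ← neg_apply, neg_sub]
    exact norm_sub_apply_sub_le hγ hθ hA hM hf hg (zero_le) hk1 (hst.trans htT) (zero_le)
      (hcs _) ((hct _).trans htT) (by linarith) (by linarith)
  have e3 : gridSum f g n t - gridSum f g n s - f s (g t - g s) =
      ((∑ i ∈ Finset.range ((n + 1) ^ 2), f (c i) (g (c (i + 1)) - g (c i))) - f s (g t - g s)) +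
      ∑ i ∈ Finset.range ((n + 1) ^ 2), (f (p i) - f (c i)) (g (c (i + 1)) - g (c i)) := by
    rw [gridSum_sub f g n hst]
    simp only [sub_apply, Finset.sum_sub_distrib]
    abel
  rw [e3]
  exact (norm_add_le _ _).trans (add_le_add e1 e2)

/-- Young's theorem: the indefinite Riemann-Stieltjes integral exists when the Hölder exponents of
integrand and integrator sum to more than `1`. -/
theorem exists_hasRSIntegral [ProperSpace E] {f : ℝ≥0 → F →L[ℝ] E} {g : ℝ≥0 → F} {γ θ : ℝ}
    (hγ : 0 < γ) (hθ : 0 < θ) (hμ : 1 < γ + θ) (hf : LocHolder γ f) (hg : LocHolder θ g) :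
    ∃ J : ℝ≥0 → E, J 0 = 0 ∧ ∀ s t, s ≤ t → HasRSIntegral f g s t (J t - J s) := by
  have hS0 : ∀ n, gridSum f g n 0 = 0 := fun n => by simp [gridSum]
  -- Bounded sums in a proper space converge along an ultrafilter, so no Cauchy estimate between
  -- grids is needed. The two-point estimate survives in the limit and, by
  -- `hasRSIntegral_of_norm_sub_le`, identifies it as the true integral.
  let U : Ultrafilter ℕ := Filter.hyperfilter ℕ
  have hU : (U : Filter ℕ) ≤ Filter.atTop := Nat.hyperfilter_le_atTop
  have hlim : ∀ t, ∃ L, Filter.Tendsto (fun n => gridSum f g n t) U (nhds L) := by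
    intro t
    obtain ⟨A, hA, hfA⟩ := hf t
    obtain ⟨M, hM, hgM⟩ := hg t
    set R : ℝ := youngConst (γ + θ) * (A * M) * ((t : ℝ) - (0 : ℝ≥0)) ^ (γ + θ) + A * M * 1 +
      ‖f 0 (g t - g 0)‖ with hR
    have hb : ∀ᶠ n in (U : Filter ℕ), gridSum f g n t ∈ Metric.closedBall (0 : E) R := by
      refine hU ?_
      obtain ⟨N, hN⟩ := exists_nat_ge t
      filter_upwards [Filter.eventually_ge_atTop N] with n hn
      have h1 := norm_gridSum_sub_le hγ hθ hμ hA hM hfA hgM (zero_le : (0 : ℝ≥0) ≤ t) le_rfl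
        (hN.trans (by exact_mod_cast hn : (N : ℝ≥0) ≤ n))
      rw [hS0, sub_zero] at h1
      have h2 : (1 / ((n : ℝ) + 1)) ^ (γ + θ) ≤ 1 := by
        apply Real.rpow_le_one (by positivity) _ (by linarith)
        rw [div_le_one (by positivity)]
        linarith [(Nat.cast_nonneg n : (0 : ℝ) ≤ n)]
      have h3 := mul_le_mul_of_nonneg_left h2 (mul_nonneg hA hM)
      have h4 := norm_sub_norm_le (gridSum f g n t) (f 0 (g t - g 0))
      rw [mem_closedBall_zero_iff]
      linarith
    obtain ⟨L, -, hL⟩ := (isCompact_closedBall (0 : E) R).ultrafilter_le_nhds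
      (U.map fun n => gridSum f g n t) (by rw [Filter.le_principal_iff]; exact hb)
    exact ⟨L, hL⟩
  choose J hJ using hlim
  refine ⟨J, ?_, fun s t hst => ?_⟩
  · refine tendsto_nhds_unique (hJ 0) ?_
    simp only [hS0]
    exact tendsto_const_nhds
  · obtain ⟨A, hA, hfA⟩ := hf t
    obtain ⟨M, hM, hgM⟩ := hg t
    have hC := youngConst_pos hμ
    refine hasRSIntegral_of_norm_sub_le (C := youngConst (γ + θ) * (A * M)) hγ hθ hμ hA hM
      (by positivity) (hfA.mono zero_le le_rfl) (hgM.mono zero_le le_rfl)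
      fun x y _ hxy hyt => ?_
    have h1 : Filter.Tendsto (fun n => ‖gridSum f g n y - gridSum f g n x - f x (g y - g x)‖) U
        (nhds ‖J y - J x - f x (g y - g x)‖) :=
      (((hJ y).sub (hJ x)).sub_const _).norm
    have h2 : Filter.Tendsto (fun n : ℕ => youngConst (γ + θ) * (A * M) * ((y : ℝ) - x) ^ (γ + θ) +
        A * M * (1 / ((n : ℝ) + 1)) ^ (γ + θ)) U
        (nhds (youngConst (γ + θ) * (A * M) * ((y : ℝ) - x) ^ (γ + θ) + A * M * 0 ^ (γ + θ))) := by
      refine Filter.Tendsto.mono_left ?_ hU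
      refine Filter.Tendsto.const_add _ (Filter.Tendsto.const_mul _ ?_)
      exact tendsto_one_div_add_atTop_nhds_zero_nat.rpow_const (Or.inr (by linarith))
    rw [Real.zero_rpow (by linarith), mul_zero, add_zero] at h2
    refine le_of_tendsto_of_tendsto h1 h2 (hU ?_)
    obtain ⟨N, hN⟩ := exists_nat_ge y
    filter_upwards [Filter.eventually_ge_atTop N] with n hn
    exact norm_gridSum_sub_le hγ hθ hμ hA hM hfA hgM hxy hyt
      (hN.trans (by exact_mod_cast hn : (N : ℝ≥0) ≤ n))

end Young

/-! ### Exponentially weighted local Hölder bounds -/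

/-- `Z` is locally `θ`-Hölder at scale `h` on `[0, T]`, with a constant that is allowed to grow
like `exp (t / h)`. -/
def WeightedBound {E : Type*} [NormedAddCommGroup E] (θ h : ℝ) (T : ℝ≥0) (D : ℝ)
    (Z : ℝ≥0 → E) : Prop :=
  ∀ s t : ℝ≥0, s ≤ t → t ≤ T → (t : ℝ) - s ≤ h →
    ‖Z t - Z s‖ ≤ D * Real.exp (t / h) * ((t : ℝ) - s) ^ θ

section Weighted

variable {E : Type*} [NormedAddCommGroup E] {θ h : ℝ} {T : ℝ≥0} {D : ℝ} {Z : ℝ≥0 → E}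

theorem one_le_exp_div (hh : 0 < h) (t : ℝ≥0) : 1 ≤ Real.exp (t / h) :=
  Real.one_le_exp (by positivity)

theorem HolderBound.weightedBound (hh : 0 < h) (hD : 0 ≤ D) (hZ : HolderBound θ D 0 T Z) :
    WeightedBound θ h T D Z := by
  intro s t hst ht _
  have e1 : (0 : ℝ) ≤ (t : ℝ) - s := sub_nonneg.2 (by exact_mod_cast hst)
  refine (hZ s t zero_le hst ht).trans ?_
  gcongr
  exact le_mul_of_one_le_right hD (one_le_exp_div hh t)

theorem WeightedBound.mono (hZ : WeightedBound θ h T D Z) {D' : ℝ} (hD : D ≤ D') :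
    WeightedBound θ h T D' Z := by
  intro s t hst ht hh
  have e1 : (0 : ℝ) ≤ (t : ℝ) - s := sub_nonneg.2 (by exact_mod_cast hst)
  exact (hZ s t hst ht hh).trans (by gcongr)

theorem two_mul_exp_neg_one_le : 2 * Real.exp (-1) ≤ 1 := by
  rw [Real.exp_neg]
  have h1 := Real.add_one_le_exp (1 : ℝ)
  have h2 := Real.exp_pos 1
  rw [← div_eq_mul_inv, div_le_one h2]
  linarith

/-- Going back by `h` multiplies the weight by `exp (-1)`, and `2 * exp (-1) + 1 ≤ 2`, so the
constant `2` reproduces itself at each step instead of growing with the number of steps. -/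
theorem WeightedBound.norm_le (hZ : WeightedBound θ h T D Z) (hθ : 0 < θ) (hh : 0 < h)
    (hD : 0 ≤ D) {t : ℝ≥0} (ht : t ≤ T) : ‖Z t‖ ≤ ‖Z 0‖ + 2 * D * h ^ θ * Real.exp (t / h) := by
  have key : ∀ n : ℕ, ∀ t : ℝ≥0, (t : ℝ) ≤ n * h → t ≤ T →
      ‖Z t‖ ≤ ‖Z 0‖ + 2 * D * h ^ θ * Real.exp (t / h) := by
    intro n
    induction n with
    | zero =>
      intro t h1 _
      rw [Nat.cast_zero, zero_mul] at h1
      have : t = 0 := le_antisymm (by exact_mod_cast h1) zero_le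
      rw [this]
      have : 0 ≤ 2 * D * h ^ θ * Real.exp ((0 : ℝ≥0) / h) := by positivity
      linarith
    | succ n ih =>
      intro t h1 h2
      have hw := Real.exp_pos (t / h)
      rcases le_total (t : ℝ) h with h3 | h3
      · have h4 := hZ 0 t zero_le h2 (by simpa using h3)
        have h5 : ((t : ℝ) - (0 : ℝ≥0)) ^ θ ≤ h ^ θ := by
          rw [NNReal.coe_zero, sub_zero]
          exact Real.rpow_le_rpow t.2 h3 hθ.le
        have h6 := mul_le_mul_of_nonneg_left h5 (mul_nonneg hD hw.le)
        have h7 := norm_sub_norm_le (Z t) (Z 0)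
        have h8 : 0 ≤ D * h ^ θ * Real.exp (t / h) := by positivity
        linarith
      · lift h to ℝ≥0 using hh.le
        have h3' : h ≤ t := by exact_mod_cast h3
        have hc : ((t - h : ℝ≥0) : ℝ) = t - h := NNReal.coe_sub h3'
        have hh' : (h : ℝ) ≠ 0 := hh.ne'
        have h4 := ih (t - h) (by rw [hc]; push_cast at h1; linarith) (tsub_le_self.trans h2)
        have h5 := hZ (t - h) t tsub_le_self h2 (by rw [hc]; linarith)
        rw [hc] at h4 h5
        rw [sub_sub_cancel] at h5
        have h6 : Real.exp ((t - h) / h) = Real.exp (t / h) * Real.exp (-1) := by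
          rw [← Real.exp_add]
          congr 1
          field_simp
          ring
        rw [h6] at h4
        have h7 := norm_sub_norm_le (Z t) (Z (t - h))
        have h8 : 0 ≤ D * h ^ θ * Real.exp (t / h) := by positivity
        have h9 := mul_le_mul_of_nonneg_left two_mul_exp_neg_one_le h8
        nlinarith
  obtain ⟨n, hn⟩ := exists_nat_ge ((t : ℝ) / h)
  exact key n t (by rwa [div_le_iff₀ hh] at hn) ht

theorem WeightedBound.norm_le_of_le (hZ : WeightedBound θ h T D Z) (hθ : 0 < θ) (hh : 0 < h)
    (hD : 0 ≤ D) {u t : ℝ≥0} (hut : u ≤ t) (ht : t ≤ T) :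
    ‖Z u‖ ≤ (‖Z 0‖ + 2 * D * h ^ θ) * Real.exp (t / h) := by
  refine (hZ.norm_le hθ hh hD (hut.trans ht)).trans ?_
  rw [add_mul]
  have h1 : Real.exp (u / h) ≤ Real.exp (t / h) := by
    apply Real.exp_le_exp.2
    gcongr
  gcongr
  exact le_mul_of_one_le_right (norm_nonneg _) (one_le_exp_div hh t)

/-- For increments longer than `h`, the supremum bound suffices, since `h ^ θ` is then at most the
required power of the length. -/
theorem WeightedBound.holderBound (hZ : WeightedBound θ h T D Z) (hθ : 0 < θ) (hh : 0 < h)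
    (hD : 0 ≤ D) :
    HolderBound θ (2 * ‖Z 0‖ * (h ^ θ)⁻¹ + 4 * D * Real.exp (T / h)) 0 T Z := by
  intro s t _ hst ht
  have e1 : (0 : ℝ) ≤ (t : ℝ) - s := sub_nonneg.2 (by exact_mod_cast hst)
  have hw : Real.exp (t / h) ≤ Real.exp (T / h) := by
    apply Real.exp_le_exp.2
    gcongr
  have hp : 0 < h ^ θ := by positivity
  rcases le_total ((t : ℝ) - s) h with h1 | h1
  · refine (hZ s t hst ht h1).trans ?_
    gcongr
    have h2 : D * Real.exp (t / h) ≤ D * Real.exp (T / h) := by gcongr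
    have h3 : 0 ≤ D * Real.exp (T / h) := by positivity
    have h4 : 0 ≤ 2 * ‖Z 0‖ * (h ^ θ)⁻¹ := by positivity
    linarith
  · have h2 := hZ.norm_le hθ hh hD (hst.trans ht)
    have h3 := hZ.norm_le hθ hh hD ht
    have hw' : Real.exp (s / h) ≤ Real.exp (T / h) := by
      apply Real.exp_le_exp.2
      gcongr
      exact hst.trans ht
    have h4 : 2 * D * h ^ θ * Real.exp (s / h) ≤ 2 * D * h ^ θ * Real.exp (T / h) := by gcongr
    have h5 : 2 * D * h ^ θ * Real.exp (t / h) ≤ 2 * D * h ^ θ * Real.exp (T / h) := by gcongr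
    have h6 : h ^ θ ≤ ((t : ℝ) - s) ^ θ := Real.rpow_le_rpow hh.le h1 hθ.le
    calc ‖Z t - Z s‖ ≤ ‖Z t‖ + ‖Z s‖ := norm_sub_le _ _
      _ ≤ 2 * ‖Z 0‖ + 4 * D * h ^ θ * Real.exp (T / h) := by linarith
      _ = (2 * ‖Z 0‖ * (h ^ θ)⁻¹ + 4 * D * Real.exp (T / h)) * h ^ θ := by
        field_simp
      _ ≤ _ := by gcongr

/-- A weighted bound that improves itself by a factor `1 / 2`, up to a constant `P`, is bounded by
`2 * P`. -/
theorem WeightedBound.of_halving {P : ℝ} (hP : 0 ≤ P) (hD : 0 ≤ D) (hZ : WeightedBound θ h T D Z)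
    (H : ∀ D', 0 ≤ D' → WeightedBound θ h T D' Z → WeightedBound θ h T (P + 1 / 2 * D') Z) :
    WeightedBound θ h T (2 * P) Z := by
  have key : ∀ n : ℕ, WeightedBound θ h T (2 * P + D * (1 / 2) ^ n) Z := by
    intro n
    induction n with
    | zero => exact hZ.mono (by linarith)
    | succ n ih =>
      refine (H _ (by positivity) ih).mono (le_of_eq ?_)
      rw [pow_succ]
      ring
  intro s t hst ht hh
  have hlim : Filter.Tendsto (fun n : ℕ => (2 * P + D * (1 / 2) ^ n) * Real.exp (t / h) *
      ((t : ℝ) - s) ^ θ) Filter.atTop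
      (nhds ((2 * P + D * 0) * Real.exp (t / h) * ((t : ℝ) - s) ^ θ)) :=
    (((((tendsto_pow_atTop_nhds_zero_of_lt_one (by norm_num) (by norm_num)).const_mul
      D).const_add (2 * P)).mul_const _).mul_const _)
  rw [mul_zero, add_zero] at hlim
  exact ge_of_tendsto' hlim fun n => key n s t hst ht hh

theorem HolderBound.sub {θ : ℝ} {X Y : ℝ≥0 → E} {C C' : ℝ} {a b : ℝ≥0}
    (hX : HolderBound θ C a b X) (hY : HolderBound θ C' a b Y) :
    HolderBound θ (C + C') a b (fun t => X t - Y t) := by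
  intro s t ha hst hb
  dsimp only
  rw [sub_sub_sub_comm, add_mul]
  exact (norm_sub_le _ _).trans (add_le_add (hX s t ha hst hb) (hY s t ha hst hb))

/-- Trades Hölder exponent for a power of the scale; this is one source of the small factor in the
Picard estimates. -/
theorem rpow_le_mul_rpow {x h γ θ : ℝ} (hx : 0 ≤ x) (hxh : x ≤ h) (hγ : 0 ≤ γ) (hγθ : γ ≤ θ) :
    x ^ θ ≤ h ^ (θ - γ) * x ^ γ := by
  have e : x ^ θ = x ^ (θ - γ) * x ^ γ := by
    rw [← Real.rpow_add_of_nonneg hx (by linarith) hγ]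
    congr 1
    ring
  rw [e]
  gcongr

theorem LocHolder.comp_of_le {G : Type*} [NormedAddCommGroup G] {X : ℝ≥0 → E}
    (hX : LocHolder θ X) {φ : E → G} {K : ℝ} (hK : 0 ≤ K) (hφ : ∀ x y, ‖φ x - φ y‖ ≤ K * ‖x - y‖) :
    LocHolder θ (fun u => φ (X u)) := by
  intro T
  obtain ⟨C, hC, h⟩ := hX T
  refine ⟨K * C, by positivity, fun s t h1 h2 h3 => (hφ _ _).trans ?_⟩
  rw [mul_assoc]
  gcongr
  exact h s t h1 h2 h3

end Weighted

/-! ### Coefficients -/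

/-- Quantitative form of the regularity of the coefficients. -/
structure CoeffBounds {F E : Type*} [NormedAddCommGroup F] [NormedSpace ℝ F]
    [NormedAddCommGroup E] [NormedSpace ℝ E] (b : E → E) (σ : E → F →L[ℝ] E)
    (K S H α : ℝ) : Prop where
  K_nonneg : 0 ≤ K
  S_nonneg : 0 ≤ S
  H_nonneg : 0 ≤ H
  drift : ∀ x y, ‖b x - b y‖ ≤ K * ‖x - y‖
  bounded : ∀ x, ‖σ x‖ ≤ S
  lipschitz : ∀ x y, ‖σ x - σ y‖ ≤ K * ‖x - y‖
  four_point : ∀ x y x' y' r, ‖x - x'‖ ≤ r → ‖y - y'‖ ≤ r →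
    ‖(σ x - σ y) - (σ x' - σ y')‖ ≤ K * ‖(x - y) - (x' - y')‖ + H * r ^ α * ‖x' - y'‖

/-- Apply the mean value inequality to `σ (p u) - σ (p' u)`, where `p` and `p'` run along the
segments from `y` to `x` and from `y'` to `x'`. By convexity `p u` and `p' u` stay within `r`, so
the derivatives differ by at most `H * r ^ α`. -/
theorem four_point_le {E G : Type*} [NormedAddCommGroup E] [NormedSpace ℝ E]
    [NormedAddCommGroup G] [NormedSpace ℝ G] {σ : E → G} {α K H : ℝ} (hα : 0 ≤ α) (hH : 0 ≤ H)
    (hσ : Differentiable ℝ σ) (hK : ∀ x, ‖fderiv ℝ σ x‖ ≤ K)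
    (hHα : ∀ x y, ‖fderiv ℝ σ x - fderiv ℝ σ y‖ ≤ H * ‖x - y‖ ^ α)
    {x y x' y' : E} {r : ℝ} (hx : ‖x - x'‖ ≤ r) (hy : ‖y - y'‖ ≤ r) :
    ‖(σ x - σ y) - (σ x' - σ y')‖ ≤ K * ‖(x - y) - (x' - y')‖ + H * r ^ α * ‖x' - y'‖ := by
  set p : ℝ → E := fun u => y + u • (x - y) with hp
  set p' : ℝ → E := fun u => y' + u • (x' - y') with hp'
  have hpd : ∀ u, HasDerivAt p (x - y) u := fun u => by
    simpa only [one_smul, id] using ((hasDerivAt_id u).smul_const (x - y)).const_add y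
  have hpd' : ∀ u, HasDerivAt p' (x' - y') u := fun u => by
    simpa only [one_smul, id] using ((hasDerivAt_id u).smul_const (x' - y')).const_add y'
  have hd : ∀ u, HasDerivAt (fun u => σ (p u) - σ (p' u))
      (fderiv ℝ σ (p u) (x - y) - fderiv ℝ σ (p' u) (x' - y')) u := fun u =>
    ((hσ (p u)).hasFDerivAt.comp_hasDerivAt u (hpd u)).sub
      ((hσ (p' u)).hasFDerivAt.comp_hasDerivAt u (hpd' u))
  have hbound : ∀ u ∈ Set.Ico (0 : ℝ) 1,
      ‖fderiv ℝ σ (p u) (x - y) - fderiv ℝ σ (p' u) (x' - y')‖ ≤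
        K * ‖(x - y) - (x' - y')‖ + H * r ^ α * ‖x' - y'‖ := by
    intro u hu
    have e : fderiv ℝ σ (p u) (x - y) - fderiv ℝ σ (p' u) (x' - y') =
        fderiv ℝ σ (p u) ((x - y) - (x' - y')) +
          (fderiv ℝ σ (p u) - fderiv ℝ σ (p' u)) (x' - y') := by
      rw [map_sub _ (x - y), sub_apply]
      abel
    have hpp : ‖p u - p' u‖ ≤ r := by
      have : p u - p' u = (1 - u) • (y - y') + u • (x - x') := by
        simp only [hp, hp', smul_sub, sub_smul, one_smul]
        abel
      rw [this]
      refine (norm_add_le _ _).trans ?_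
      rw [norm_smul, norm_smul, Real.norm_of_nonneg hu.1,
        Real.norm_of_nonneg (sub_nonneg.2 hu.2.le)]
      have h1 := mul_le_mul_of_nonneg_left hy (sub_nonneg.2 hu.2.le)
      have h2 := mul_le_mul_of_nonneg_left hx hu.1
      linarith
    rw [e]
    refine (norm_add_le _ _).trans (add_le_add ?_ ?_)
    · exact (ContinuousLinearMap.le_opNorm _ _).trans (by gcongr; exact hK _)
    · refine (ContinuousLinearMap.le_opNorm _ _).trans ?_
      gcongr
      exact (hHα _ _).trans (by gcongr)
  have h1 := norm_image_sub_le_of_norm_deriv_le_segment_01'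
    (fun u _ => (hd u).hasDerivWithinAt) hbound
  have e : (σ x - σ y) - (σ x' - σ y') = σ (p 1) - σ (p' 1) - (σ (p 0) - σ (p' 0)) := by
    simp only [hp, hp', one_smul, zero_smul, add_zero, add_sub_cancel]
    abel
  rw [e]
  exact h1

theorem exists_coeffBounds {F E : Type*} [NormedAddCommGroup F] [NormedSpace ℝ F]
    [NormedAddCommGroup E] [InnerProductSpace ℝ E] [CompleteSpace E] {b : E → E}
    {σ : E → F →L[ℝ] E} (hC : AssumptionC b σ) (hb : ∃ K : ℝ≥0, LipschitzWith K b) {α : ℝ}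
    (hσ : IsOnePlusLipschitz α σ) : ∃ K S H : ℝ, CoeffBounds b σ K S H α := by
  obtain ⟨S, hS⟩ := hC.bounded
  obtain ⟨K₁, hK₁⟩ := hb
  obtain ⟨K₂, hK₂⟩ := hC.lipschitz
  set H : ℝ≥0∞ := ⨆ (x : E) (y : E) (_ : x ≠ y),
    ‖fderiv ℝ σ x - fderiv ℝ σ y‖ₑ / ENNReal.ofReal (‖x - y‖ ^ α) with hH
  have hHtop : H ≠ ⊤ := ne_top_of_le_ne_top hσ.norm_lt_top.ne le_add_self
  have hHα : ∀ x y, ‖fderiv ℝ σ x - fderiv ℝ σ y‖ ≤ H.toReal * ‖x - y‖ ^ α := by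
    intro x y
    rcases eq_or_ne x y with rfl | hxy
    · simp only [sub_self, norm_zero]
      exact (norm_zero (E := E →L[ℝ] F →L[ℝ] E)).trans_le
        (mul_nonneg ENNReal.toReal_nonneg (Real.rpow_nonneg le_rfl _))
    have h0 : 0 < ‖x - y‖ ^ α := Real.rpow_pos_of_pos (norm_pos_iff.2 (sub_ne_zero.2 hxy)) α
    have h1 : ‖fderiv ℝ σ x - fderiv ℝ σ y‖ₑ / ENNReal.ofReal (‖x - y‖ ^ α) ≤ H :=
      le_iSup_of_le x (le_iSup_of_le y (le_iSup_of_le hxy le_rfl))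
    rw [ENNReal.div_le_iff (by simpa using h0) ENNReal.ofReal_ne_top] at h1
    have h2 := ENNReal.toReal_mono (ENNReal.mul_ne_top hHtop ENNReal.ofReal_ne_top) h1
    rwa [ENNReal.toReal_mul, ENNReal.toReal_ofReal h0.le, toReal_enorm] at h2
  have hK : ∀ x, ‖fderiv ℝ σ x‖ ≤ (max K₁ K₂ : ℝ≥0) := fun x =>
    norm_fderiv_le_of_lipschitz ℝ (hK₂.weaken (le_max_right _ _))
  refine ⟨(max K₁ K₂ : ℝ≥0), S, H.toReal, NNReal.coe_nonneg _, (norm_nonneg _).trans (hS 0),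
    ENNReal.toReal_nonneg, fun x y => ?_, hS, fun x y => ?_, fun x y x' y' r hx hy => ?_⟩
  · exact (hK₁.weaken (le_max_left _ _)).norm_sub_le x y
  · exact (hK₂.weaken (le_max_right _ _)).norm_sub_le x y
  · exact four_point_le hσ.pos.le ENNReal.toReal_nonneg (hσ.contDiff.differentiable (by norm_num))
      hK hHα hx hy

/-! ### The Picard map -/

/-- `X'` is the image of `X` under the Picard map of the equation. -/
def IsPicardImage {F E : Type*} [NormedAddCommGroup F] [NormedSpace ℝ F]
    [NormedAddCommGroup E] [NormedSpace ℝ E]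
    (b : E → E) (σ : E → F →L[ℝ] E) (x₀ : E) (B : ℝ≥0 → F) (X X' : ℝ≥0 → E) : Prop :=
  ∀ t : ℝ≥0, ∃ I J : E,
    HasRSIntegral (fun u => ContinuousLinearMap.toSpanSingleton ℝ (b (X u)))
      (fun u => (u : ℝ)) 0 t I ∧
    HasRSIntegral (fun u => σ (X u)) B 0 t J ∧
    X' t = x₀ + I + J

section Picard

variable {F E : Type*} [NormedAddCommGroup F] [NormedSpace ℝ F]
  [NormedAddCommGroup E] [NormedSpace ℝ E]
  {b : E → E} {σ : E → F →L[ℝ] E} {K S H α θ : ℝ}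

theorem locHolder_coe : LocHolder 1 (fun u : ℝ≥0 => (u : ℝ)) := by
  refine fun T => ⟨1, zero_le_one, fun s t _ hst _ => ?_⟩
  rw [Real.rpow_one, one_mul, Real.norm_of_nonneg (sub_nonneg.2 (by exact_mod_cast hst))]

theorem CoeffBounds.drift_toSpanSingleton (hc : CoeffBounds b σ K S H α) (x y : E) :
    ‖ContinuousLinearMap.toSpanSingleton ℝ (b x) - ContinuousLinearMap.toSpanSingleton ℝ (b y)‖ ≤
      K * ‖x - y‖ := by
  have e : ContinuousLinearMap.toSpanSingleton ℝ (b x) -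
      ContinuousLinearMap.toSpanSingleton ℝ (b y) =
      ContinuousLinearMap.toSpanSingleton ℝ (b x - b y) := by
    ext
    simp
  rw [e, ContinuousLinearMap.norm_toSpanSingleton]
  exact hc.drift x y

/-- The integrals in the Picard map exist. -/
theorem CoeffBounds.exists_integrals [ProperSpace E] (hc : CoeffBounds b σ K S H α)
    (hθ : 1 / 2 < θ) {B : ℝ≥0 → F} {X : ℝ≥0 → E} (hB : LocHolder θ B) (hX : LocHolder θ X) :
    ∃ I J : ℝ≥0 → E, I 0 = 0 ∧ J 0 = 0 ∧
      (∀ s t, s ≤ t → HasRSIntegral (fun u => ContinuousLinearMap.toSpanSingleton ℝ (b (X u)))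
        (fun u => (u : ℝ)) s t (I t - I s)) ∧
      (∀ s t, s ≤ t → HasRSIntegral (fun u => σ (X u)) B s t (J t - J s)) := by
  obtain ⟨I, hI0, hI⟩ := exists_hasRSIntegral (by linarith) one_pos (by linarith)
    (hX.comp_of_le (φ := fun x => ContinuousLinearMap.toSpanSingleton ℝ (b x)) hc.K_nonneg
      hc.drift_toSpanSingleton) locHolder_coe
  obtain ⟨J, hJ0, hJ⟩ := exists_hasRSIntegral (by linarith) (by linarith) (by linarith)
    (hX.comp_of_le hc.K_nonneg hc.lipschitz) hB
  exact ⟨I, J, hI0, hJ0, hI, hJ⟩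

theorem CoeffBounds.exists_isPicardImage [ProperSpace E] (hc : CoeffBounds b σ K S H α)
    (hθ : 1 / 2 < θ) {B : ℝ≥0 → F} {X : ℝ≥0 → E} (hB : LocHolder θ B) (hX : LocHolder θ X)
    (x₀ : E) : ∃ X', IsPicardImage b σ x₀ B X X' := by
  obtain ⟨I, J, hI0, hJ0, hI, hJ⟩ := hc.exists_integrals hθ hB hX
  refine ⟨fun t => x₀ + I t + J t, fun t => ⟨I t, J t, ?_, ?_, rfl⟩⟩
  · simpa [hI0] using hI 0 t zero_le
  · simpa [hJ0] using hJ 0 t zero_le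

/-- The definition only supplies integrals from `0`. Young's theorem supplies indefinite integrals
with the right increments on every `[s, t]`, and uniqueness matches the two. -/
theorem IsPicardImage.increments [ProperSpace E] (hc : CoeffBounds b σ K S H α)
    (hθ : 1 / 2 < θ) {B : ℝ≥0 → F} {X X' : ℝ≥0 → E} {x₀ : E} (hB : LocHolder θ B)
    (hX : LocHolder θ X) (h : IsPicardImage b σ x₀ B X X') :
    X' 0 = x₀ ∧ ∀ s t, s ≤ t → ∃ I J : E,
      HasRSIntegral (fun u => ContinuousLinearMap.toSpanSingleton ℝ (b (X u)))
        (fun u => (u : ℝ)) s t I ∧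
      HasRSIntegral (fun u => σ (X u)) B s t J ∧ X' t - X' s = I + J := by
  obtain ⟨I, J, hI0, hJ0, hI, hJ⟩ := hc.exists_integrals hθ hB hX
  have hX' : ∀ t, X' t = x₀ + I t + J t := by
    intro t
    obtain ⟨i, j, hi, hj, e⟩ := h t
    rw [e, hi.unique zero_le (hI 0 t zero_le), hj.unique zero_le (hJ 0 t zero_le), hI0, hJ0,
      sub_zero, sub_zero]
  refine ⟨by rw [hX', hI0, hJ0, add_zero, add_zero], fun s t hst =>
    ⟨I t - I s, J t - J s, hI s t hst, hJ s t hst, ?_⟩⟩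
  rw [hX', hX']
  abel

/-- The Picard map improves weighted bounds at small scales. -/
theorem IsPicardImage.weightedBound [ProperSpace E] (hc : CoeffBounds b σ K S H α)
    (hθ : 1 / 2 < θ) (hθ1 : θ ≤ 1) (hα : 0 < α) (hα1 : α < 1) (hμ : 1 < α * θ + θ)
    {B : ℝ≥0 → F} {X X' : ℝ≥0 → E} {x₀ : E} (hB : LocHolder θ B) (hX : LocHolder θ X)
    (h : IsPicardImage b σ x₀ B X X') {η M L : ℝ} {T : ℝ≥0} (hη : 0 < η) (hη1 : η ≤ 1)
    (hM : 0 ≤ M) (hBM : HolderBound θ M 0 T B) (hL : 0 ≤ L) (hXL : WeightedBound θ η T L X) :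
    WeightedBound θ η T ((‖b 0‖ + K * ‖X 0‖ + S * M) +
      (2 * K + youngConst (α * θ + θ) * K * M) * η ^ θ * L) X' := by
  intro s t hst htT hts
  obtain ⟨I, J, hI, hJ, e⟩ := (h.increments hc hθ hB hX).2 s t hst
  have hK := hc.K_nonneg
  have hS := hc.S_nonneg
  have hθ0 : 0 < θ := by linarith
  have hγ : 0 < α * θ := by positivity
  have hγθ : α * θ ≤ θ := mul_le_of_le_one_left hθ0.le hα1.le
  have hC := youngConst_pos hμ
  set C := youngConst (α * θ + θ) with hCdef
  set w := Real.exp (t / η) with hw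
  have hw1 : 1 ≤ w := one_le_exp_div hη t
  have hw0 : 0 < w := by linarith
  set x : ℝ := (t : ℝ) - s with hx
  have hx0 : 0 ≤ x := sub_nonneg.2 (by exact_mod_cast hst)
  have hηθ : 0 < η ^ θ := by positivity
  have hxθ : x ≤ x ^ θ := by
    have := Real.rpow_le_rpow_of_exponent_ge' hx0 (hts.trans hη1) hθ0.le hθ1
    rwa [Real.rpow_one] at this
  have b1 : ‖I‖ ≤ (‖b 0‖ + K * (‖X 0‖ + 2 * L * η ^ θ)) * w * x := by
    refine hI.norm_le_of_norm_le hst fun u _ hut => ?_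
    rw [ContinuousLinearMap.norm_toSpanSingleton]
    have h1 := hXL.norm_le_of_le hθ0 hη hL hut htT
    have h2 := hc.drift (X u) 0
    rw [sub_zero] at h2
    have h3 := norm_sub_norm_le (b (X u)) (b 0)
    have h4 := mul_le_mul_of_nonneg_left h1 hK
    have h5 := le_mul_of_one_le_right (norm_nonneg (b 0)) hw1
    linarith
  -- The path `σ (X)` is even `θ`-Hölder; the weaker exponent `α * θ` is used so that the Young
  -- constant is the one of the difference estimate.
  have hHol : HolderBound (α * θ) (K * (L * w * η ^ (θ - α * θ))) s t (fun u => σ (X u)) := by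
    intro u v hu huv hv
    have huv0 : (0 : ℝ) ≤ (v : ℝ) - u := sub_nonneg.2 (by exact_mod_cast huv)
    have hvη : (v : ℝ) - u ≤ η := by
      have h1 : (v : ℝ) ≤ t := by exact_mod_cast hv
      have h2 : (s : ℝ) ≤ u := by exact_mod_cast hu
      linarith
    have h1 := hXL u v huv (hv.trans htT) hvη
    have h2 : Real.exp (v / η) ≤ w := by
      apply Real.exp_le_exp.2
      gcongr
    calc ‖σ (X v) - σ (X u)‖ ≤ K * ‖X v - X u‖ := hc.lipschitz _ _
      _ ≤ K * (L * w * (η ^ (θ - α * θ) * ((v : ℝ) - u) ^ (α * θ))) := by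
        gcongr
        refine h1.trans ?_
        gcongr
        exact rpow_le_mul_rpow huv0 hvη hγ.le hγθ
      _ = _ := by ring
  have b2 := hJ.norm_sub_le hst hγ hθ0 hμ (by positivity) hM hHol (hBM.mono zero_le htT)
  have b3 : ‖σ (X s) (B t - B s)‖ ≤ S * (M * x ^ θ) := by
    refine (ContinuousLinearMap.le_opNorm _ _).trans ?_
    gcongr
    · exact hc.bounded _
    · exact hBM s t zero_le hst htT
  have b4 : η ^ (θ - α * θ) * x ^ (α * θ + θ) ≤ η ^ θ * x ^ θ := by
    rw [Real.rpow_add_of_nonneg hx0 hγ.le hθ0.le, ← mul_assoc]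
    gcongr
    have : η ^ θ = η ^ (θ - α * θ) * η ^ (α * θ) := by
      rw [← Real.rpow_add hη]
      congr 1
      ring
    rw [this]
    gcongr
  have b5 : ‖J‖ ≤ S * (M * x ^ θ) + C * (K * L * M) * w * (η ^ θ * x ^ θ) := by
    have h1 := norm_sub_norm_le J (σ (X s) (B t - B s))
    have h2 := mul_le_mul_of_nonneg_left b4 (show 0 ≤ C * (K * L * M) * w by positivity)
    have h3 : C * (K * (L * w * η ^ (θ - α * θ)) * M) * x ^ (α * θ + θ) =
      C * (K * L * M) * w * (η ^ (θ - α * θ) * x ^ (α * θ + θ)) := by ring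
    rw [h3] at b2
    linarith
  have b6 : ‖I‖ ≤ (‖b 0‖ + K * (‖X 0‖ + 2 * L * η ^ θ)) * w * x ^ θ := b1.trans (by gcongr)
  have b7 : S * (M * x ^ θ) ≤ S * M * w * x ^ θ := by
    have : 0 ≤ S * M * x ^ θ := by positivity
    have := le_mul_of_one_le_right this hw1
    linarith
  rw [e]
  refine (norm_add_le _ _).trans ((add_le_add b6 b5).trans ?_)
  refine (add_le_add_right (add_le_add_left b7 _) _).trans (le_of_eq ?_)
  ring

/-- The Picard map contracts weighted bounds of differences at small scales. -/
theorem IsPicardImage.weightedBound_sub [ProperSpace E] (hc : CoeffBounds b σ K S H α)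
    (hθ : 1 / 2 < θ) (hθ1 : θ ≤ 1) (hα : 0 < α) (hα1 : α < 1) (hμ : 1 < α * θ + θ)
    {B B' : ℝ≥0 → F} {X X' Y Y' : ℝ≥0 → E} {x₀ y₀ : E} (hB : LocHolder θ B) (hB' : LocHolder θ B')
    (hX : LocHolder θ X) (hY : LocHolder θ Y)
    (h : IsPicardImage b σ x₀ B X X') (h' : IsPicardImage b σ y₀ B' Y Y')
    {η M N R D : ℝ} {T : ℝ≥0} (hη : 0 < η) (hη1 : η ≤ 1)
    (hM : 0 ≤ M) (hBM : HolderBound θ M 0 T B)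
    (hN : 0 ≤ N) (hBN : HolderBound θ N 0 T (fun t => B t - B' t))
    (hR : 0 ≤ R) (hXR : HolderBound θ R 0 T X) (hYR : HolderBound θ R 0 T Y)
    (hD : 0 ≤ D) (hXY : WeightedBound θ η T D (fun t => X t - Y t)) :
    WeightedBound θ η T
      (((K + K * M + youngConst (α * θ + θ) * M * H * R ^ α) * ‖X 0 - Y 0‖ +
        (S + youngConst (α * θ + θ) * K * R) * N) +
      (2 * K + 2 * K * M + youngConst (α * θ + θ) * M * K +
        2 * youngConst (α * θ + θ) * M * H * R ^ α) * η ^ θ * D) (fun t => X' t - Y' t) := by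
  intro s t hst htT hts
  obtain ⟨I, J, hI, hJ, e⟩ := (h.increments hc hθ hB hX).2 s t hst
  obtain ⟨I', J', hI', hJ', e'⟩ := (h'.increments hc hθ hB' hY).2 s t hst
  have hγ₀ : (0 : ℝ) < θ := by linarith
  -- The mixed integral `∫ σ (Y) dB` separates the change of integrand from the change of
  -- integrator.
  obtain ⟨G, -, hG⟩ := exists_hasRSIntegral hγ₀ hγ₀ (by linarith)
    (hY.comp_of_le hc.K_nonneg hc.lipschitz) hB
  replace hG := hG s t hst
  set J'' := G t - G s with hJ''
  have hK := hc.K_nonneg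
  have hS := hc.S_nonneg
  have hH := hc.H_nonneg
  have hθ0 : 0 < θ := by linarith
  have hγ : 0 < α * θ := by positivity
  have hγθ : α * θ ≤ θ := mul_le_of_le_one_left hθ0.le hα1.le
  have hC := youngConst_pos hμ
  set C := youngConst (α * θ + θ) with hCdef
  set w := Real.exp (t / η) with hw
  have hw1 : 1 ≤ w := one_le_exp_div hη t
  have hw0 : 0 < w := by linarith
  set x : ℝ := (t : ℝ) - s with hx
  have hx0 : 0 ≤ x := sub_nonneg.2 (by exact_mod_cast hst)
  have hηθ : 0 < η ^ θ := by positivity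
  have hηθ1 : η ^ θ ≤ 1 := Real.rpow_le_one hη.le hη1 hθ0.le
  have hxθ : x ≤ x ^ θ := by
    have := Real.rpow_le_rpow_of_exponent_ge' hx0 (hts.trans hη1) hθ0.le hθ1
    rwa [Real.rpow_one] at this
  have hRα : 0 ≤ R ^ α := by positivity
  set W : ℝ := ‖X 0 - Y 0‖ + 2 * D * η ^ θ with hW
  have hW0 : 0 ≤ W := by positivity
  have hsup : ∀ u, u ≤ t → ‖X u - Y u‖ ≤ W * w := fun u hut =>
    hXY.norm_le_of_le hθ0 hη hD hut htT
  have hlen : ∀ u v : ℝ≥0, s ≤ u → u ≤ v → v ≤ t → (0 : ℝ) ≤ (v : ℝ) - u ∧ (v : ℝ) - u ≤ η := by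
    intro u v hu huv hv
    have h1 : (v : ℝ) ≤ t := by exact_mod_cast hv
    have h2 : (s : ℝ) ≤ u := by exact_mod_cast hu
    have h3 : (u : ℝ) ≤ v := by exact_mod_cast huv
    exact ⟨by linarith, by linarith⟩
  have hηpow : η ^ (θ - α * θ) * η ^ (α * θ) = η ^ θ := by
    rw [← Real.rpow_add hη]
    congr 1
    ring
  have hxη : x ^ (α * θ) ≤ η ^ (α * θ) := Real.rpow_le_rpow hx0 hts hγ.le
  have hη1' : η ^ (α * θ) ≤ 1 := Real.rpow_le_one hη.le hη1 hγ.le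
  have hxsplit : x ^ (α * θ + θ) = x ^ (α * θ) * x ^ θ :=
    Real.rpow_add_of_nonneg hx0 hγ.le hθ0.le
  -- the drift
  have b1 : ‖I - I'‖ ≤ K * (W * w) * x := by
    refine (hI.sub_left hI').norm_le_of_norm_le hst fun u _ hut => ?_
    exact (hc.drift_toSpanSingleton _ _).trans (by gcongr; exact hsup u hut)
  have b1' : ‖I - I'‖ ≤ K * W * w * x ^ θ := b1.trans (by rw [← mul_assoc]; gcongr)
  -- the change of the integrand
  have hHol : HolderBound (α * θ) ((K * D * η ^ (θ - α * θ) + H * R ^ α * W) * w) s t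
      (fun u => σ (X u) - σ (Y u)) := by
    intro u v hu huv hv
    obtain ⟨h0, h1⟩ := hlen u v hu huv hv
    -- Here `r` is the size of the increments of `X` and `Y`, so `r ^ α` carries the exponent `α *
    -- θ`.
    have h2 := hc.four_point (X v) (Y v) (X u) (Y u) (R * ((v : ℝ) - u) ^ θ)
      (hXR u v zero_le huv (hv.trans htT)) (hYR u v zero_le huv (hv.trans htT))
    have h3 := hXY u v huv (hv.trans htT) h1
    have h4 : Real.exp (v / η) ≤ w := by
      apply Real.exp_le_exp.2
      gcongr
    have h5 : (R * ((v : ℝ) - u) ^ θ) ^ α = R ^ α * ((v : ℝ) - u) ^ (α * θ) := by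
      rw [Real.mul_rpow hR (by positivity), ← Real.rpow_mul h0, mul_comm θ α]
    rw [h5] at h2
    calc _ ≤ K * ‖X v - Y v - (X u - Y u)‖ +
          H * (R ^ α * ((v : ℝ) - u) ^ (α * θ)) * ‖X u - Y u‖ := h2
      _ ≤ K * (D * w * (η ^ (θ - α * θ) * ((v : ℝ) - u) ^ (α * θ))) +
          H * (R ^ α * ((v : ℝ) - u) ^ (α * θ)) * (W * w) := by
        gcongr
        · refine h3.trans ?_
          gcongr
          exact rpow_le_mul_rpow h0 h1 hγ.le hγθ
        · exact hsup u (huv.trans hv)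
      _ = _ := by ring
  have b2 := (hJ.sub_left hG).norm_sub_le hst hγ hθ0 hμ (by positivity) hM hHol
    (hBM.mono zero_le htT)
  have b3 : ‖(σ (X s) - σ (Y s)) (B t - B s)‖ ≤ K * (W * w) * (M * x ^ θ) := by
    refine (ContinuousLinearMap.le_opNorm _ _).trans ?_
    gcongr
    · exact (hc.lipschitz _ _).trans (by gcongr; exact hsup s hst)
    · exact hBM s t zero_le hst htT
  have b4 : C * ((K * D * η ^ (θ - α * θ) + H * R ^ α * W) * w * M) * x ^ (α * θ + θ) ≤
      C * M * (K * D * η ^ θ + H * R ^ α * W) * w * x ^ θ := by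
    have h1 : (K * D * η ^ (θ - α * θ) + H * R ^ α * W) * x ^ (α * θ) ≤
        K * D * η ^ θ + H * R ^ α * W := by
      rw [add_mul]
      refine add_le_add ?_ (mul_le_of_le_one_right (by positivity) (hxη.trans hη1'))
      rw [← hηpow, ← mul_assoc]
      gcongr
    have h2 := mul_le_mul_of_nonneg_left h1 (show 0 ≤ C * M * w * x ^ θ by positivity)
    rw [hxsplit]
    linarith
  have b5 : ‖J - J''‖ ≤ (K * M * W + C * M * (K * D * η ^ θ + H * R ^ α * W)) * w * x ^ θ := by
    have h1 := norm_sub_norm_le (J - J'') ((σ (X s) - σ (Y s)) (B t - B s))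
    linarith
  -- the change of the integrator
  have hHol' : HolderBound (α * θ) (K * R * η ^ (θ - α * θ)) s t (fun u => σ (Y u)) := by
    intro u v hu huv hv
    obtain ⟨h0, h1⟩ := hlen u v hu huv hv
    calc ‖σ (Y v) - σ (Y u)‖ ≤ K * ‖Y v - Y u‖ := hc.lipschitz _ _
      _ ≤ K * (R * (η ^ (θ - α * θ) * ((v : ℝ) - u) ^ (α * θ))) := by
        gcongr
        refine (hYR u v zero_le huv (hv.trans htT)).trans ?_
        gcongr
        exact rpow_le_mul_rpow h0 h1 hγ.le hγθ
      _ = _ := by ring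
  have b6 := (hG.sub_right hJ').norm_sub_le hst hγ hθ0 hμ (by positivity) hN hHol'
    (hBN.mono zero_le htT)
  have b7 : ‖σ (Y s) (B t - B' t - (B s - B' s))‖ ≤ S * (N * x ^ θ) := by
    refine (ContinuousLinearMap.le_opNorm _ _).trans ?_
    gcongr
    · exact hc.bounded _
    · exact hBN s t zero_le hst htT
  have b8 : C * (K * R * η ^ (θ - α * θ) * N) * x ^ (α * θ + θ) ≤ C * K * R * N * x ^ θ := by
    have h1 : η ^ (θ - α * θ) * x ^ (α * θ) ≤ 1 := by
      refine le_trans ?_ hηθ1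
      rw [← hηpow]
      gcongr
    have h2 := mul_le_mul_of_nonneg_left h1 (show 0 ≤ C * K * R * N * x ^ θ by positivity)
    rw [hxsplit]
    linarith
  have b9 : ‖J'' - J'‖ ≤ (S + C * K * R) * N * w * x ^ θ := by
    have h1 := norm_sub_norm_le (J'' - J') (σ (Y s) (B t - B' t - (B s - B' s)))
    have h2 : (S + C * K * R) * N * x ^ θ ≤ (S + C * K * R) * N * x ^ θ * w :=
      le_mul_of_one_le_right (by positivity) hw1
    linarith
  have e3 : X' t - Y' t - (X' s - Y' s) = (I - I') + (J - J'') + (J'' - J') := by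
    rw [sub_sub_sub_comm, e, e']
    abel
  dsimp only
  rw [e3]
  refine (norm_add₃_le).trans ((add_le_add (add_le_add b1' b5) b9).trans (le_of_eq ?_))
  rw [hW]
  ring

end Picard

/-! ### Existence and stability of solutions -/

/-- The denominator `2 * (Q + 1)` also covers `Q = 0`. -/
theorem exists_scale {θ Q : ℝ} (hθ : 0 < θ) (hQ : 0 ≤ Q) :
    ∃ η : ℝ, 0 < η ∧ η ≤ 1 ∧ Q * η ^ θ ≤ 1 / 2 := by
  set c : ℝ := 1 / (2 * (Q + 1)) with hc
  have hc0 : 0 < c := by positivity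
  refine ⟨min 1 (c ^ (1 / θ)), lt_min one_pos (by positivity), min_le_left _ _, ?_⟩
  have h1 : (min 1 (c ^ (1 / θ))) ^ θ ≤ c := by
    calc _ ≤ (c ^ (1 / θ)) ^ θ := by
          gcongr
          exact min_le_right _ _
      _ = c := by rw [← Real.rpow_mul hc0.le, one_div_mul_cancel hθ.ne', Real.rpow_one]
  calc Q * (min 1 (c ^ (1 / θ))) ^ θ ≤ (Q + 1) * c := by
        gcongr
        linarith
    _ = 1 / 2 := by
        rw [hc]
        field_simp

section Solve

variable {F E : Type*} [NormedAddCommGroup F] [NormedSpace ℝ F]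
  [NormedAddCommGroup E] [NormedSpace ℝ E] [ProperSpace E]
  {b : E → E} {σ : E → F →L[ℝ] E} {K S H α θ : ℝ}

/-- For given coefficients, the scale depends only on the Hölder bound `M` of the driver, not on the
path or its bound `L`. It can therefore be kept along the whole iteration. -/
theorem CoeffBounds.exists_invariance_scale (hc : CoeffBounds b σ K S H α)
    (hθ : 1 / 2 < θ) (hθ1 : θ ≤ 1) (hα : 0 < α) (hα1 : α < 1) (hμ : 1 < α * θ + θ)
    {M : ℝ} (hM : 0 ≤ M) :
    ∃ η : ℝ, 0 < η ∧ η ≤ 1 ∧ ∀ (T : ℝ≥0) (B : ℝ≥0 → F) (X X' : ℝ≥0 → E) (x₀ : E),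
      LocHolder θ B → LocHolder θ X → IsPicardImage b σ x₀ B X X' → HolderBound θ M 0 T B →
      ∀ L, 0 ≤ L → WeightedBound θ η T L X →
        WeightedBound θ η T ((‖b 0‖ + K * ‖X 0‖ + S * M) + 1 / 2 * L) X' := by
  have hK := hc.K_nonneg
  have hC := youngConst_pos hμ
  obtain ⟨η, hη, hη1, hQ⟩ := exists_scale (θ := θ)
    (Q := 2 * K + youngConst (α * θ + θ) * K * M) (by linarith) (by positivity)
  refine ⟨η, hη, hη1, fun T B X X' x₀ hB hX h hBM L hL hXL => ?_⟩
  refine (h.weightedBound hc hθ hθ1 hα hα1 hμ hB hX hη hη1 hM hBM hL hXL).mono ?_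
  gcongr

/-- Here the scale also depends on a Hölder bound `R` for both paths, because of the term `R ^ α`
from the four-point inequality; such a bound has to be secured beforehand. -/
theorem CoeffBounds.exists_contraction_scale (hc : CoeffBounds b σ K S H α)
    (hθ : 1 / 2 < θ) (hθ1 : θ ≤ 1) (hα : 0 < α) (hα1 : α < 1) (hμ : 1 < α * θ + θ)
    {M R : ℝ} (hM : 0 ≤ M) (hR : 0 ≤ R) :
    ∃ η a : ℝ, 0 < η ∧ η ≤ 1 ∧ 0 ≤ a ∧
      ∀ (T : ℝ≥0) (B B' : ℝ≥0 → F) (X X' Y Y' : ℝ≥0 → E) (x₀ y₀ : E) (N : ℝ),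
      LocHolder θ B → LocHolder θ B' → LocHolder θ X → LocHolder θ Y →
      IsPicardImage b σ x₀ B X X' → IsPicardImage b σ y₀ B' Y Y' →
      HolderBound θ M 0 T B → 0 ≤ N → HolderBound θ N 0 T (fun t => B t - B' t) →
      HolderBound θ R 0 T X → HolderBound θ R 0 T Y →
      ∀ D, 0 ≤ D → WeightedBound θ η T D (fun t => X t - Y t) →
        WeightedBound θ η T (a * (‖X 0 - Y 0‖ + N) + 1 / 2 * D) (fun t => X' t - Y' t) := by
  have hK := hc.K_nonneg
  have hS := hc.S_nonneg
  have hH := hc.H_nonneg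
  have hC := youngConst_pos hμ
  obtain ⟨η, hη, hη1, hQ⟩ := exists_scale (θ := θ)
    (Q := 2 * K + 2 * K * M + youngConst (α * θ + θ) * M * K +
        2 * youngConst (α * θ + θ) * M * H * R ^ α) (by linarith) (by positivity)
  refine ⟨η, (K + K * M + youngConst (α * θ + θ) * M * H * R ^ α) +
    (S + youngConst (α * θ + θ) * K * R), hη, hη1, by positivity, ?_⟩
  intro T B B' X X' Y Y' x₀ y₀ N hB hB' hX hY h h' hBM hN hBN hXR hYR D hD hXY
  refine (h.weightedBound_sub hc hθ hθ1 hα hα1 hμ hB hB' hX hY h' hη hη1 hM hBM hN hBN hR hXR hYR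
    hD hXY).mono ?_
  refine add_le_add ?_ (by gcongr)
  have h1 : 0 ≤ (K + K * M + youngConst (α * θ + θ) * M * H * R ^ α) * N := by positivity
  have h2 : 0 ≤ (S + youngConst (α * θ + θ) * K * R) * ‖X 0 - Y 0‖ := by positivity
  linarith

theorem IsPicardImage.locHolder (hc : CoeffBounds b σ K S H α)
    (hθ : 1 / 2 < θ) (hθ1 : θ ≤ 1) (hα : 0 < α) (hα1 : α < 1) (hμ : 1 < α * θ + θ)
    {B : ℝ≥0 → F} {X X' : ℝ≥0 → E} {x₀ : E} (hB : LocHolder θ B) (hX : LocHolder θ X)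
    (h : IsPicardImage b σ x₀ B X X') : LocHolder θ X' := by
  intro T
  have hK := hc.K_nonneg
  have hS := hc.S_nonneg
  obtain ⟨M, hM, hBM⟩ := hB T
  obtain ⟨L, hL, hXL⟩ := hX T
  obtain ⟨η, hη, hη1, hinv⟩ := hc.exists_invariance_scale hθ hθ1 hα hα1 hμ hM
  have h1 := hinv T B X X' x₀ hB hX h hBM L hL (hXL.weightedBound hη hL)
  exact ⟨_, by positivity, h1.holderBound (by linarith) hη (by positivity)⟩

/-- Existence of solutions, by Picard iteration. -/
theorem CoeffBounds.exists_solution (hc : CoeffBounds b σ K S H α)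
    (hθ : 1 / 2 < θ) (hθ1 : θ ≤ 1) (hα : 0 < α) (hα1 : α < 1) (hμ : 1 < α * θ + θ)
    {B : ℝ≥0 → F} (hB : LocHolder θ B) (x₀ : E) :
    ∃ X, LocHolder θ X ∧ IsPicardImage b σ x₀ B X X := by
  have hK := hc.K_nonneg
  have hS := hc.S_nonneg
  have hθ0 : 0 < θ := by linarith
  have hstep : ∀ X : {X : ℝ≥0 → E // LocHolder θ X}, ∃ X' : {X : ℝ≥0 → E // LocHolder θ X},
      IsPicardImage b σ x₀ B X.1 X'.1 := by
    intro X
    obtain ⟨X', h⟩ := hc.exists_isPicardImage hθ hB X.2 x₀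
    exact ⟨⟨X', h.locHolder hc hθ hθ1 hα hα1 hμ hB X.2⟩, h⟩
  choose G hG using hstep
  have hconst : ∀ (C : ℝ) (T : ℝ≥0), 0 ≤ C → HolderBound θ C 0 T (fun _ => x₀) := by
    intro C T hC s t _ hst _
    have e1 : (0 : ℝ) ≤ (t : ℝ) - s := sub_nonneg.2 (by exact_mod_cast hst)
    rw [sub_self, norm_zero]
    positivity
  let X : ℕ → {X : ℝ≥0 → E // LocHolder θ X} :=
    fun n => G^[n] ⟨fun _ => x₀, fun T => ⟨0, le_rfl, hconst 0 T le_rfl⟩⟩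
  have hX0 : (X 0).1 = fun _ => x₀ := rfl
  have hXs : ∀ n, IsPicardImage b σ x₀ B (X n).1 (X (n + 1)).1 := by
    intro n
    have : X (n + 1) = G (X n) := Function.iterate_succ_apply' _ _ _
    rw [this]
    exact hG _
  have hXi : ∀ n, (X n).1 0 = x₀ := by
    intro n
    cases n with
    | zero => rfl
    | succ n => exact ((hXs n).increments hc hθ hB (X n).2).1
  have hzero : ∀ T, HolderBound θ 0 0 T (fun t => B t - B t) := by
    intro T s t _ _ _
    simp
  -- estimates on each bounded interval
  have hest : ∀ T : ℝ≥0, ∃ η R : ℝ, 0 < η ∧ 0 ≤ R ∧ (∀ n, HolderBound θ R 0 T (X n).1) ∧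
      ∀ Y Y' Z Z' : ℝ≥0 → E, LocHolder θ Y → LocHolder θ Z → IsPicardImage b σ x₀ B Y Y' →
        IsPicardImage b σ x₀ B Z Z' → Y 0 = x₀ → Z 0 = x₀ →
        HolderBound θ R 0 T Y → HolderBound θ R 0 T Z → ∀ D, 0 ≤ D →
        WeightedBound θ η T D (fun t => Y t - Z t) →
        WeightedBound θ η T (1 / 2 * D) (fun t => Y' t - Z' t) := by
    intro T
    obtain ⟨M, hM, hBM⟩ := hB T
    obtain ⟨η₀, hη₀, -, hinv⟩ := hc.exists_invariance_scale hθ hθ1 hα hα1 hμ hM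
    set P : ℝ := ‖b 0‖ + K * ‖x₀‖ + S * M with hP
    have hP0 : 0 ≤ P := by positivity
    -- The level `2 * P` is invariant since `P + 1 / 2 * (2 * P) = 2 * P`. This gives the uniform
    -- Hölder constant `R` that the contraction requires.
    have hw : ∀ n, WeightedBound θ η₀ T (2 * P) (X n).1 := by
      intro n
      induction n with
      | zero =>
        rw [hX0]
        exact (hconst (2 * P) T (by positivity)).weightedBound hη₀ (by positivity)
      | succ n ih =>
        have h1 := hinv T B _ _ x₀ hB (X n).2 (hXs n) hBM (2 * P) (by positivity) ih
        rw [hXi] at h1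
        exact h1.mono (by linarith)
    set R : ℝ := 2 * ‖x₀‖ * (η₀ ^ θ)⁻¹ + 4 * (2 * P) * Real.exp (T / η₀) with hR
    have hR0 : 0 ≤ R := by positivity
    obtain ⟨η, a, hη, -, -, hcon⟩ := hc.exists_contraction_scale hθ hθ1 hα hα1 hμ hM hR0
    refine ⟨η, R, hη, hR0, fun n => ?_, ?_⟩
    · have h1 := (hw n).holderBound hθ0 hη₀ (by positivity)
      rwa [hXi] at h1
    · intro Y Y' Z Z' hY hZ hYY hZZ hY0 hZ0 hYR hZR D hD hYZ
      have h1 := hcon T B B Y Y' Z Z' x₀ x₀ 0 hB hB hY hZ hYY hZZ hBM le_rfl (hzero T) hYR hZR D hD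
        hYZ
      refine h1.mono (le_of_eq ?_)
      rw [hY0, hZ0, sub_self, norm_zero]
      ring
  have hcau : ∀ (T : ℝ≥0) (η R : ℝ), 0 < η → 0 ≤ R → (∀ n, HolderBound θ R 0 T (X n).1) →
      (∀ Y Y' Z Z' : ℝ≥0 → E, LocHolder θ Y → LocHolder θ Z → IsPicardImage b σ x₀ B Y Y' →
        IsPicardImage b σ x₀ B Z Z' → Y 0 = x₀ → Z 0 = x₀ →
        HolderBound θ R 0 T Y → HolderBound θ R 0 T Z → ∀ D, 0 ≤ D →
        WeightedBound θ η T D (fun t => Y t - Z t) →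
        WeightedBound θ η T (1 / 2 * D) (fun t => Y' t - Z' t)) →
      ∀ n k, WeightedBound θ η T ((R + R) * (1 / 2) ^ n)
        (fun t => (X (n + k)).1 t - (X n).1 t) := by
    intro T η R hη hR hXR hcon n
    induction n with
    | zero =>
      intro k
      refine (((hXR (0 + k)).sub (hXR 0)).weightedBound hη (by positivity)).mono ?_
      rw [pow_zero, mul_one]
    | succ n ih =>
      intro k
      have h1 := hcon _ _ _ _ (X (n + k)).2 (X n).2 (hXs (n + k)) (hXs n) (hXi _) (hXi _)
        (hXR _) (hXR _) _ (by positivity) (ih k)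
      have e : n + 1 + k = n + k + 1 := by omega
      rw [e]
      refine h1.mono (le_of_eq ?_)
      rw [pow_succ]
      ring
  have hgeom : ∀ c d : ℝ, Filter.Tendsto (fun n : ℕ => c * (1 / 2) ^ n * d) Filter.atTop
      (nhds 0) := by
    intro c d
    have := ((tendsto_pow_atTop_nhds_zero_of_lt_one (r := (1 / 2 : ℝ)) (by norm_num)
      (by norm_num)).const_mul c).mul_const d
    simpa using this
  have hlim : ∀ t, ∃ L, Filter.Tendsto (fun n => (X n).1 t) Filter.atTop (nhds L) := by
    intro t
    obtain ⟨η, R, hη, hR, hXR, hcon⟩ := hest t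
    have hc' := hcau t η R hη hR hXR hcon
    refine cauchySeq_tendsto_of_complete (cauchySeq_of_le_tendsto_0
      (fun n => 2 * ((R + R) * (1 / 2) ^ n * (2 * η ^ θ * Real.exp (t / η)))) ?_ ?_)
    · have hs : ∀ N n, N ≤ n → dist ((X n).1 t) ((X N).1 t) ≤
          (R + R) * (1 / 2) ^ N * (2 * η ^ θ * Real.exp (t / η)) := by
        intro N n hn
        obtain ⟨k, rfl⟩ := Nat.exists_eq_add_of_le hn
        have h1 := (hc' N k).norm_le hθ0 hη (by positivity) (le_refl t)
        simp only [hXi, sub_self, norm_zero, zero_add] at h1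
        rw [dist_eq_norm]
        linarith
      intro n m N hn hm
      have h1 := hs N n hn
      have h2 := hs N m hm
      have h3 := dist_triangle_right ((X n).1 t) ((X m).1 t) ((X N).1 t)
      linarith
    · have := (hgeom (R + R) (2 * η ^ θ * Real.exp (t / η))).const_mul 2
      simpa only [mul_zero] using this
  choose Z hZ using hlim
  have hZ0 : Z 0 = x₀ := by
    refine tendsto_nhds_unique (hZ 0) ?_
    simp only [hXi]
    exact tendsto_const_nhds
  have hZR : ∀ (T : ℝ≥0) (R : ℝ), (∀ n, HolderBound θ R 0 T (X n).1) → HolderBound θ R 0 T Z := by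
    intro T R hXR s t hs hst ht
    exact le_of_tendsto' ((hZ t).sub (hZ s)).norm fun n => hXR n s t hs hst ht
  have hZloc : LocHolder θ Z := by
    intro T
    obtain ⟨η, R, hη, hR, hXR, hcon⟩ := hest T
    exact ⟨R, hR, hZR T R hXR⟩
  -- The limit `Z` is a fixed point: by contraction the iterates `X (n + 1)` converge to its Picard
  -- image `Z'`, while they also converge to `Z`.
  obtain ⟨Z', hZ'⟩ := hc.exists_isPicardImage hθ hB hZloc x₀
  have hZ'0 : Z' 0 = x₀ := (hZ'.increments hc hθ hB hZloc).1
  have hfix : Z' = Z := by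
    funext t
    obtain ⟨η, R, hη, hR, hXR, hcon⟩ := hest t
    have hc' := hcau t η R hη hR hXR hcon
    -- Let `k` tend to infinity in the Cauchy estimate between `X (n + k)` and `X n`.
    have hw : ∀ n, WeightedBound θ η t ((R + R) * (1 / 2) ^ n) (fun t => Z t - (X n).1 t) := by
      intro n s u hsu hut hη'
      refine le_of_tendsto' (((((hZ u).comp (Filter.tendsto_add_atTop_nat n)).sub_const _).sub
        (((hZ s).comp (Filter.tendsto_add_atTop_nat n)).sub_const _)).norm) fun k => ?_
      have := hc' n k s u hsu hut hη'
      simpa only [Function.comp_apply, add_comm k n] using this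
    have hw' : ∀ n, ‖(X (n + 1)).1 t - Z' t‖ ≤
        (R + R) * (1 / 2) ^ n * (η ^ θ * Real.exp (t / η)) := by
      intro n
      have h1 := hcon _ _ _ _ hZloc (X n).2 hZ' (hXs n) hZ0 (hXi n) (hZR t R hXR) (hXR n) _
        (by positivity) (hw n)
      have h2 := h1.norm_le hθ0 hη (by positivity) (le_refl t)
      simp only [hXi, hZ'0, sub_self, norm_zero, zero_add] at h2
      rw [norm_sub_rev]
      linarith
    have h1 : Filter.Tendsto (fun n => (X (n + 1)).1 t) Filter.atTop (nhds (Z' t)) :=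
      tendsto_iff_norm_sub_tendsto_zero.2
        (squeeze_zero (fun _ => norm_nonneg _) hw' (hgeom _ _))
    exact tendsto_nhds_unique h1 ((hZ t).comp (Filter.tendsto_add_atTop_nat 1))
  exact ⟨Z, hZloc, hfix ▸ hZ'⟩

/-- A priori bound: solutions are Hölder on `[0, T]` uniformly for drivers and starting points in
bounded sets. -/
theorem CoeffBounds.exists_apriori_bound (hc : CoeffBounds b σ K S H α)
    (hθ : 1 / 2 < θ) (hθ1 : θ ≤ 1) (hα : 0 < α) (hα1 : α < 1) (hμ : 1 < α * θ + θ)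
    {M r : ℝ} (hM : 0 ≤ M) (hr : 0 ≤ r) (T : ℝ≥0) :
    ∃ R : ℝ, 0 ≤ R ∧ ∀ (B : ℝ≥0 → F) (X : ℝ≥0 → E) (x₀ : E), LocHolder θ B → LocHolder θ X →
      IsPicardImage b σ x₀ B X X → HolderBound θ M 0 T B → ‖x₀‖ ≤ r → HolderBound θ R 0 T X := by
  have hK := hc.K_nonneg
  have hS := hc.S_nonneg
  have hθ0 : 0 < θ := by linarith
  obtain ⟨η, hη, -, hinv⟩ := hc.exists_invariance_scale hθ hθ1 hα hα1 hμ hM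
  set P : ℝ := ‖b 0‖ + K * r + S * M with hP
  have hP0 : 0 ≤ P := by positivity
  refine ⟨2 * r * (η ^ θ)⁻¹ + 4 * (2 * P) * Real.exp (T / η), by positivity, ?_⟩
  intro B X x₀ hB hX h hBM hx₀
  obtain ⟨L, hL, hXL⟩ := hX T
  have hX0 : X 0 = x₀ := (h.increments hc hθ hB hX).1
  -- Local Hölder continuity provides some finite bound `L` to start from; the halving argument
  -- removes the dependence on it.
  have h1 : WeightedBound θ η T (2 * P) X := by
    refine WeightedBound.of_halving hP0 hL (hXL.weightedBound hη hL) fun D hD hXD => ?_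
    refine (hinv T B X X x₀ hB hX h hBM D hD hXD).mono ?_
    rw [hX0, hP]
    gcongr
  have h2 := h1.holderBound hθ0 hη (by positivity)
  intro s t hs hst ht
  have e1 : (0 : ℝ) ≤ (t : ℝ) - s := sub_nonneg.2 (by exact_mod_cast hst)
  refine (h2 s t hs hst ht).trans ?_
  rw [hX0]
  gcongr

/-- Local Lipschitz continuity of the solution in the starting point and the driver. -/
theorem CoeffBounds.exists_stability_const (hc : CoeffBounds b σ K S H α)
    (hθ : 1 / 2 < θ) (hθ1 : θ ≤ 1) (hα : 0 < α) (hα1 : α < 1) (hμ : 1 < α * θ + θ)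
    {B : ℝ≥0 → F} {X : ℝ≥0 → E} {x₀ : E} (hB : LocHolder θ B) (hX : LocHolder θ X)
    (h : IsPicardImage b σ x₀ B X X) (T : ℝ≥0) :
    ∃ C : ℝ, 0 ≤ C ∧ ∀ (B' : ℝ≥0 → F) (Y : ℝ≥0 → E) (y₀ : E) (N : ℝ), LocHolder θ B' →
      LocHolder θ Y → IsPicardImage b σ y₀ B' Y Y → ‖x₀ - y₀‖ ≤ 1 → 0 ≤ N → N ≤ 1 →
      HolderBound θ N 0 T (fun t => B t - B' t) →
      (∀ t ≤ T, ‖X t - Y t‖ ≤ C * (‖x₀ - y₀‖ + N)) ∧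
        HolderBound θ (C * (‖x₀ - y₀‖ + N)) 0 T (fun t => X t - Y t) := by
  have hθ0 : 0 < θ := by linarith
  obtain ⟨M, hM, hBM⟩ := hB T
  -- Data within distance `1` of `(x₀, B)` have constants at most `‖x₀‖ + 1` and `M + 1`, so one `R`
  -- serves both solutions.
  obtain ⟨R, hR, hap⟩ := hc.exists_apriori_bound hθ hθ1 hα hα1 hμ
    (show 0 ≤ M + 1 by positivity) (show 0 ≤ ‖x₀‖ + 1 by positivity) T
  obtain ⟨η, a, hη, hη1, ha, hcon⟩ := hc.exists_contraction_scale hθ hθ1 hα hα1 hμ hM hR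
  have hw : 0 < Real.exp (T / η) := Real.exp_pos _
  have hηθ : 0 < η ^ θ := by positivity
  -- The sum of the constants from `WeightedBound.norm_le` (first two terms) and
  -- `WeightedBound.holderBound` (last two), applied with `D = 2 * a * (‖x₀ - y₀‖ + N)`.
  refine ⟨1 + 4 * a * η ^ θ * Real.exp (T / η) + 2 * (η ^ θ)⁻¹ + 8 * a * Real.exp (T / η),
    by positivity, ?_⟩
  intro B' Y y₀ N hB' hY h' hxy hN hN1 hBN
  have hBM1 : HolderBound θ (M + 1) 0 T B := by
    intro s t hs hst ht
    have e1 : (0 : ℝ) ≤ (t : ℝ) - s := sub_nonneg.2 (by exact_mod_cast hst)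
    refine (hBM s t hs hst ht).trans ?_
    gcongr
    linarith
  have hBM2 : HolderBound θ (M + 1) 0 T B' := by
    intro s t hs hst ht
    have e1 : (0 : ℝ) ≤ (t : ℝ) - s := sub_nonneg.2 (by exact_mod_cast hst)
    have h1 := hBM s t hs hst ht
    have h2 := hBN s t hs hst ht
    have h3 : N * ((t : ℝ) - s) ^ θ ≤ 1 * ((t : ℝ) - s) ^ θ := by gcongr
    have h4 : B' t - B' s = (B t - B s) - (B t - B' t - (B s - B' s)) := by abel
    rw [h4, add_mul]
    exact (norm_sub_le _ _).trans (by linarith)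
  have hy₀ : ‖y₀‖ ≤ ‖x₀‖ + 1 := by
    have := norm_sub_norm_le y₀ x₀
    rw [norm_sub_rev] at this
    linarith
  have hXR := hap B X x₀ hB hX h hBM1 (by linarith)
  have hYR := hap B' Y y₀ hB' hY h' hBM2 hy₀
  have hX0 : X 0 = x₀ := (h.increments hc hθ hB hX).1
  have hY0 : Y 0 = y₀ := (h'.increments hc hθ hB' hY).1
  set z : ℝ := ‖x₀ - y₀‖ with hz
  have hz0 : 0 ≤ z := norm_nonneg _
  have hW : WeightedBound θ η T (2 * (a * (z + N))) (fun t => X t - Y t) := by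
    refine WeightedBound.of_halving (D := R + R) (by positivity) (by positivity)
      ((hXR.sub hYR).weightedBound hη (by positivity)) fun D hD hXYD => ?_
    have h1 := hcon T B B' X X Y Y x₀ y₀ N hB hB' hX hY h h' hBM hN hBN hXR hYR D hD hXYD
    rwa [hX0, hY0] at h1
  have hzN : 0 ≤ z + N := by positivity
  refine ⟨fun t ht => ?_, fun s t hs hst ht => ?_⟩
  · have h0 := hW.norm_le hθ0 hη (by positivity) ht
    have hexp : Real.exp (t / η) ≤ Real.exp (T / η) := by
      apply Real.exp_le_exp.2
      gcongr
    simp only [hX0, hY0, ← hz] at h0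
    calc ‖X t - Y t‖ ≤ z + 2 * (2 * (a * (z + N))) * η ^ θ * Real.exp (T / η) := by
          refine h0.trans ?_
          gcongr
      _ ≤ (1 + 4 * a * η ^ θ * Real.exp (T / η)) * (z + N) := by linarith
      _ ≤ _ := by
          refine mul_le_mul_of_nonneg_right ?_ hzN
          have : 0 ≤ 2 * (η ^ θ)⁻¹ + 8 * a * Real.exp (T / η) := by positivity
          linarith
  · have e1 : (0 : ℝ) ≤ (t : ℝ) - s := sub_nonneg.2 (by exact_mod_cast hst)
    have h1 := hW.holderBound hθ0 hη (by positivity) s t hs hst ht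
    simp only [hX0, hY0, ← hz] at h1
    refine h1.trans ?_
    gcongr
    have h2 : 0 ≤ (η ^ θ)⁻¹ * N := by positivity
    have h3 : 0 ≤ (1 + 4 * a * η ^ θ * Real.exp (T / η)) * (z + N) := by positivity
    linarith

end Solve

/-! ### Hölder path spaces -/

section Paths

variable {E : Type*} [NormedAddCommGroup E] {θ : ℝ}

theorem HolderBound.holderSeminorm_le {C : ℝ} {T : ℝ≥0} {f : ℝ≥0 → E}
    (h : HolderBound θ C 0 T f) : holderSeminorm θ T f ≤ ENNReal.ofReal C := by
  refine iSup_le fun s => iSup_le fun t => iSup_le fun hst => iSup_le fun ht => ?_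
  have h0 : (0 : ℝ) < (t : ℝ) - s := sub_pos.2 (by exact_mod_cast hst)
  have h1 : 0 < ((t : ℝ) - s) ^ θ := Real.rpow_pos_of_pos h0 θ
  rw [ENNReal.div_le_iff (by simpa using h1) ENNReal.ofReal_ne_top,
    ← ENNReal.ofReal_mul' h1.le, ← ofReal_norm]
  exact ENNReal.ofReal_le_ofReal (h s t zero_le hst.le ht)

theorem holderBound_of_holderSeminorm_le {C : ℝ} (hC : 0 ≤ C) {T : ℝ≥0} {f : ℝ≥0 → E}
    (h : holderSeminorm θ T f ≤ ENNReal.ofReal C) : HolderBound θ C 0 T f := by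
  intro s t _ hst ht
  have h0 : (0 : ℝ) ≤ (t : ℝ) - s := sub_nonneg.2 (by exact_mod_cast hst)
  rcases hst.eq_or_lt with rfl | hst'
  · rw [sub_self, norm_zero]
    positivity
  have h1 : 0 < ((t : ℝ) - s) ^ θ :=
    Real.rpow_pos_of_pos (sub_pos.2 (by exact_mod_cast hst')) θ
  have h2 : ‖f t - f s‖ₑ / ENNReal.ofReal (((t : ℝ) - (s : ℝ)) ^ θ) ≤ holderSeminorm θ T f :=
    le_iSup_of_le s (le_iSup_of_le t (le_iSup_of_le hst' (le_iSup_of_le ht le_rfl)))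
  replace h2 := h2.trans h
  rw [ENNReal.div_le_iff (by simpa using h1) ENNReal.ofReal_ne_top,
    ← ENNReal.ofReal_mul' h1.le, ← ofReal_norm] at h2
  exact (ENNReal.ofReal_le_ofReal_iff (by positivity)).1 h2

theorem HolderPath.locHolder (f : HolderPath θ E) : LocHolder θ f := by
  intro T
  -- Passing to `T + 1` covers `T = 0`, where the structure gives no information.
  have h1 := f.holder (T + 1) (by positivity)
  refine ⟨(holderSeminorm θ (T + 1) f.toFun).toReal, ENNReal.toReal_nonneg, ?_⟩
  refine HolderBound.mono (holderBound_of_holderSeminorm_le ENNReal.toReal_nonneg ?_) le_rfl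
    (le_self_add : T ≤ T + 1)
  rw [ENNReal.ofReal_toReal h1.ne]

theorem LocHolder.exists_holderPath {f : ℝ≥0 → E} (hf : LocHolder θ f) :
    ∃ X : HolderPath θ E, X.toFun = f := by
  refine ⟨⟨f, fun T _ => ?_⟩, rfl⟩
  obtain ⟨C, -, hC⟩ := hf T
  exact hC.holderSeminorm_le.trans_lt ENNReal.ofReal_lt_top

theorem supSeminorm_le {C : ℝ} {T : ℝ≥0} {f : ℝ≥0 → E} (h : ∀ t ≤ T, ‖f t‖ ≤ C) :
    supSeminorm T f ≤ ENNReal.ofReal C := by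
  refine iSup_le fun t => iSup_le fun ht => ?_
  rw [← ofReal_norm]
  exact ENNReal.ofReal_le_ofReal (h t ht)

theorem supSeminorm_mono {T T' : ℝ≥0} (hT : T ≤ T') (f : ℝ≥0 → E) :
    supSeminorm T f ≤ supSeminorm T' f :=
  iSup_le fun t => iSup_le fun ht => le_iSup_of_le t (le_iSup_of_le (ht.trans hT) le_rfl)

theorem holderSeminorm_mono {T T' : ℝ≥0} (hT : T ≤ T') (f : ℝ≥0 → E) :
    holderSeminorm θ T f ≤ holderSeminorm θ T' f :=
  iSup_le fun s => iSup_le fun t => iSup_le fun hst => iSup_le fun ht =>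
    le_iSup_of_le s (le_iSup_of_le t (le_iSup_of_le hst (le_iSup_of_le (ht.trans hT) le_rfl)))

theorem tsum_inv_two_pow : ∑' N : ℕ, (2 : ℝ≥0∞)⁻¹ ^ N = 2 := by
  rw [ENNReal.tsum_geometric, ENNReal.one_sub_inv_two, inv_inv]

/-- The truncation at `1` makes the tail of the series uniformly small, and the earlier terms are
dominated by the seminorms on `[0, N]`, with weights summing to at most `2`. -/
theorem exists_holderEDist_le (θ : ℝ) {ε : ℝ≥0∞} (hε : 0 < ε) : ∃ N : ℕ, ∀ (f g : ℝ≥0 → E),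
    holderEDist θ f g ≤
      2 * (supSeminorm (N : ℝ≥0) (f - g) + holderSeminorm θ (N : ℝ≥0) (f - g)) + ε := by
  have hlim := ENNReal.tendsto_sum_nat_add (fun N : ℕ => (2 : ℝ≥0∞)⁻¹ ^ N)
    (by rw [tsum_inv_two_pow]; simp)
  obtain ⟨N, hN⟩ := ((hlim.eventually (gt_mem_nhds hε))).exists
  refine ⟨N, fun f g => ?_⟩
  unfold holderEDist
  rw [← (ENNReal.summable).sum_add_tsum_nat_add' (k := N)]
  refine add_le_add ?_ (le_trans (ENNReal.tsum_le_tsum fun k => ?_) hN.le)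
  · have e : ∀ a : ℝ≥0∞, 2 * a = ∑' N : ℕ, (2 : ℝ≥0∞)⁻¹ ^ N * a := fun a => by
      rw [ENNReal.tsum_mul_right, tsum_inv_two_pow]
    rw [e]
    refine le_trans (Finset.sum_le_sum fun k hk => ?_) (ENNReal.sum_le_tsum (Finset.range N))
    have hkN : (k : ℝ≥0) ≤ N := by exact_mod_cast (Finset.mem_range.1 hk).le
    gcongr
    exact (min_le_right _ _).trans
      (add_le_add (supSeminorm_mono hkN (f - g)) (holderSeminorm_mono hkN (f - g)))
  · exact mul_le_of_le_one_right bot_le (min_le_left _ _)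

/-- A single term of the series is enough: below `c ≤ 1` the truncation at `1` is inactive. Only the
seminorm is kept, as solutions see the driver through its increments. -/
theorem exists_holderSeminorm_le (N : ℕ) {c : ℝ≥0∞} (hc : 0 < c) (hc1 : c ≤ 1) :
    ∃ δ : ℝ≥0∞, 0 < δ ∧ ∀ f g : ℝ≥0 → E, holderEDist θ f g < δ →
      holderSeminorm θ (N : ℝ≥0) (f - g) ≤ c := by
  have h2 : (2 : ℝ≥0∞)⁻¹ ^ N ≠ 0 := pow_ne_zero _ (by simp)
  have h2' : (2 : ℝ≥0∞)⁻¹ ^ N ≠ ⊤ := ENNReal.pow_ne_top (by simp)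
  refine ⟨(2 : ℝ≥0∞)⁻¹ ^ N * c, ENNReal.mul_pos h2 hc.ne', fun f g h => ?_⟩
  have h1 := (ENNReal.le_tsum (f := fun N : ℕ => (2 : ℝ≥0∞)⁻¹ ^ N *
    min 1 (supSeminorm (N : ℝ≥0) (f - g) + holderSeminorm θ (N : ℝ≥0) (f - g))) N).trans_lt h
  rw [ENNReal.mul_lt_mul_iff_right h2 h2'] at h1
  rcases min_lt_iff.1 h1 with h3 | h3
  · exact absurd (h3.trans_le hc1) (lt_irrefl _)
  · exact le_add_self.trans h3.le

end Paths

/-! ### Well-posedness and continuity of the Itô map -/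

theorem proposition1 (d q : ℕ)
    (b : EuclideanSpace ℝ (Fin d) → EuclideanSpace ℝ (Fin d))
    (σ : EuclideanSpace ℝ (Fin d) → EuclideanSpace ℝ (Fin q) →L[ℝ] EuclideanSpace ℝ (Fin d))
    (hC : AssumptionC b σ) (hb : ∃ K : ℝ≥0, LipschitzWith K b)
    (α : ℝ) (hσ : IsOnePlusLipschitz α σ)
    (θ : ℝ) (hθ : 1 / 2 < θ) (hθ1 : θ ≤ 1) (hα : 1 / θ - 1 < α) :
    (∀ (B : HolderPath θ (EuclideanSpace ℝ (Fin q))) (x₀ : EuclideanSpace ℝ (Fin d)),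
      ∃! X : HolderPath θ (EuclideanSpace ℝ (Fin d)), IsSolution b σ x₀ B X) ∧
    ∃ Φ : EuclideanSpace ℝ (Fin d) × HolderPath θ (EuclideanSpace ℝ (Fin q)) →
        HolderPath θ (EuclideanSpace ℝ (Fin d)),
      (∀ (x₀ : EuclideanSpace ℝ (Fin d)) (B : HolderPath θ (EuclideanSpace ℝ (Fin q))),
        IsSolution b σ x₀ B (Φ (x₀, B))) ∧
      Continuous Φ := by
  obtain ⟨K, S, H, hc⟩ := exists_coeffBounds hC hb hσ
  have hθ0 : 0 < θ := by linarith
  have hμ : 1 < α * θ + θ := by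
    have h1 := mul_lt_mul_of_pos_right hα hθ0
    rw [sub_mul, one_div_mul_cancel hθ0.ne'] at h1
    linarith
  have hex : ∀ p : EuclideanSpace ℝ (Fin d) × HolderPath θ (EuclideanSpace ℝ (Fin q)),
      ∃ X : HolderPath θ (EuclideanSpace ℝ (Fin d)), IsSolution b σ p.1 p.2 X := by
    intro p
    obtain ⟨X, hX, h⟩ := hc.exists_solution hθ hθ1 hσ.pos hσ.lt_one hμ p.2.locHolder p.1
    obtain ⟨X', rfl⟩ := hX.exists_holderPath
    -- Being a solution is by definition being one's own Picard image.
    exact ⟨X', h⟩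
  refine ⟨fun B x₀ => ?_, ?_⟩
  · obtain ⟨X, hX⟩ := hex (x₀, B)
    refine ⟨X, hX, fun Y hY => ?_⟩
    refine eq_of_edist_eq_zero ?_
    have hXY : X.toFun = Y.toFun := by
      funext t
      -- Uniqueness is stability with equal data, that is with `N = 0` and the same starting point.
      obtain ⟨C, -, hst⟩ := hc.exists_stability_const hθ hθ1 hσ.pos hσ.lt_one hμ B.locHolder
        X.locHolder hX t
      have h1 := (hst B Y x₀ 0 B.locHolder Y.locHolder hY (by simp) le_rfl zero_le_one
        (fun s t _ _ _ => by simp)).1 t le_rfl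
      simp only [sub_self, norm_zero, add_zero, mul_zero] at h1
      exact sub_eq_zero.1 (norm_le_zero_iff.1 h1)
    change holderEDist θ Y.toFun X.toFun = 0
    rw [hXY]
    simp [holderEDist, supSeminorm_zero, holderSeminorm_zero]
  · choose Φ hΦ using hex
    refine ⟨Φ, fun x₀ B => hΦ (x₀, B), continuous_iff_continuousAt.2 fun p => ?_⟩
    refine EMetric.tendsto_nhds.2 fun ε hε => ?_
    obtain ⟨ε', hε', hεε⟩ := exists_between hε
    -- Half of `ε'` pays for the tail beyond `N`, the other half for the stability estimate on `[0,
    -- N]` with both data within `r`.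
    obtain ⟨N, hN⟩ := exists_holderEDist_le (E := EuclideanSpace ℝ (Fin d)) θ
      (ENNReal.half_pos hε'.ne')
    obtain ⟨C, hC0, hst⟩ := hc.exists_stability_const hθ hθ1 hσ.pos hσ.lt_one hμ p.2.locHolder
      (Φ p).locHolder (hΦ p) (N : ℝ≥0)
    have hsmall : ∃ r : ℝ, 0 < r ∧ r ≤ 1 ∧
        2 * (ENNReal.ofReal (C * (r + r)) + ENNReal.ofReal (C * (r + r))) ≤ ε' / 2 := by
      have hlim : Filter.Tendsto (fun r : ℝ => 2 * (ENNReal.ofReal (C * (r + r)) +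
          ENNReal.ofReal (C * (r + r)))) (nhdsWithin 0 (Set.Ioi 0))
          (nhds (2 * (ENNReal.ofReal (C * (0 + 0)) + ENNReal.ofReal (C * (0 + 0))))) := by
        have hcont : Continuous fun r : ℝ => ENNReal.ofReal (C * (r + r)) +
          ENNReal.ofReal (C * (r + r)) :=
          (ENNReal.continuous_ofReal.comp (by fun_prop)).add
            (ENNReal.continuous_ofReal.comp (by fun_prop))
        exact ENNReal.Tendsto.const_mul ((hcont.tendsto 0).mono_left nhdsWithin_le_nhds)
          (Or.inr (by simp))
      simp only [add_zero, mul_zero, ENNReal.ofReal_zero] at hlim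
      have h1 := hlim.eventually (gt_mem_nhds (ENNReal.half_pos hε'.ne'))
      have h2 : ∀ᶠ r : ℝ in nhdsWithin 0 (Set.Ioi 0), r ∈ Set.Ioc (0 : ℝ) 1 :=
        Ioc_mem_nhdsGT one_pos
      obtain ⟨r, h3, h4⟩ := (h1.and h2).exists
      exact ⟨r, h4.1, h4.2, h3.le⟩
    obtain ⟨r, hr, hr1, hrε⟩ := hsmall
    obtain ⟨δ, hδ, hδB⟩ := exists_holderSeminorm_le (E := EuclideanSpace ℝ (Fin q)) (θ := θ) N
      (ENNReal.ofReal_pos.2 hr) (ENNReal.ofReal_le_one.2 hr1)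
    have ev1 : ∀ᶠ p' in nhds p, ‖p.1 - p'.1‖ < r := by
      have : Filter.Tendsto (fun p' : EuclideanSpace ℝ (Fin d) ×
          HolderPath θ (EuclideanSpace ℝ (Fin q)) => p'.1) (nhds p) (nhds p.1) :=
        continuous_fst.tendsto p
      filter_upwards [Metric.tendsto_nhds.1 this r hr] with p' hp'
      rwa [dist_comm, dist_eq_norm] at hp'
    have ev2 : ∀ᶠ p' in nhds p, edist p'.2 p.2 < δ :=
      EMetric.tendsto_nhds.1 (continuous_snd.tendsto p) δ hδ
    filter_upwards [ev1, ev2] with p' h1 h2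
    have h3 : holderEDist θ p.2.toFun p'.2.toFun < δ := by
      rw [edist_comm] at h2
      exact h2
    have h4 := holderBound_of_holderSeminorm_le hr.le (hδB _ _ h3)
    obtain ⟨h5, h6⟩ := hst p'.2 (Φ p') p'.1 r p'.2.locHolder (Φ p').locHolder (hΦ p')
      (h1.le.trans hr1) hr.le hr1 h4
    have hle : C * (‖p.1 - p'.1‖ + r) ≤ C * (r + r) := by gcongr
    have h7 : supSeminorm (N : ℝ≥0) ((Φ p).toFun - (Φ p').toFun) ≤
        ENNReal.ofReal (C * (r + r)) :=
      (supSeminorm_le h5).trans (ENNReal.ofReal_le_ofReal hle)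
    have h8 : holderSeminorm θ (N : ℝ≥0) ((Φ p).toFun - (Φ p').toFun) ≤
        ENNReal.ofReal (C * (r + r)) :=
      h6.holderSeminorm_le.trans (ENNReal.ofReal_le_ofReal hle)
    rw [edist_comm]
    change holderEDist θ (Φ p).toFun (Φ p').toFun < ε
    refine lt_of_le_of_lt ((hN _ _).trans ?_) hεε
    refine (add_le_add (le_trans ?_ hrε) le_rfl).trans (ENNReal.add_halves ε').le
    gcongr
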